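/- **Conventions.** A compact prototile set in $\mathbb R^d$ is given by a compact metric space $\mathcal L$ of labels and, for each label, a prototile: a compact set homeomorphic to a closed ball and containing its control point (the origin), which depends continuously on the label in the Hausdorff metric. A tile is a translate of a prototile together with its label. A tiling is a (locally finite) collection of tiles that covers $\mathbb R^d$ and whose distinct members meet only in their boundaries. A patch is a finite collection of tiles of a tiling with connected union. The distance $d(T,T')$ of two tilings is the infimum of $1$ and of all $\epsilon\in(0,1]$ such that $T$ and $T'$ contain patches covering the closed ball of radius $1/\epsilon$ about the origin whose tiles correspond one to one, corresponding tiles being at most $\epsilon$ apart both in the Hausdorff distance of their supports and in the distance of their labels. A tiling space is a closed, translation-invariant set $\Omega$ of tilings by a fixed compact prototile set. Its transversal is the set of $T\in\Omega$ that have a control point at the origin. $\Omega$ is expansive if there is an $\epsilon>0$ such that, for $T,T'\in\Omega$, the condition $d(T-x,T'-x)<\epsilon$ for all $x\in\mathbb R^d$ implies $T'=T-y$ for some $|y|<\epsilon$. $\Omega$ is an FLC tiling space if, up to translation, only finitely many tile types and only finitely many two-tile patches occur in its tilings. For a continuous function $\ell:\mathbb Z_2\to(0,\infty)$ let $\Omega_\ell$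 be the set of the following tilings of $\mathbb R$ by intervals. Such a tiling is given by a $2$-adic integer $p$ and a position: its tiles, in order, are $t_i$ $(i\in\mathbb Z)$, where $t_i$ is a tile of type $A_n$ with $n=v_2(p+i)\in\{0,1,2,\dots,\infty\}$ and has length $\ell(p+i)$. The label of a tile of type $A_n$ and length $s$ is the pair $(2^{-n},s)$ (with $2^{-\infty}=0$), and its control point is its left end point. For $\ell=1$ these are the dyadic solenoid tilings, in which every $2^{n+1}$-st tile is an $A_n$; in general $\Omega_\ell$ is a "stretched" dyadic solenoid. **Theorem.** There is a continuous function $\ell:\mathbb Z_2\to(0,\infty)$ such that $\Omega_\ell$ is a tiling space with totally disconnected transversal and expansive translational dynamics, and $\Omega_\ell$ is homeomorphic to the dyadic solenoid $\varprojlim(\mathbb R/2^k\mathbb Z)$ but not homeomorphic to any FLC tiling space (of any dimension, with any compact prototile set). -/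

import Mathlib

open Set Topology Metric

/-- A compact set of prototiles in `ℝ^d`: the labels form a compact metric space, every prototile
is homeomorphic to a closed ball, its control point (placed at the origin) belongs to it, and the
supports depend continuously on the label for the Hausdorff metric. -/
structure PrototileSet (d : ℕ) (L : Type*) [MetricSpace L] [CompactSpace L] where
  supp : L → TopologicalSpace.NonemptyCompacts (EuclideanSpace ℝ (Fin d))
  homeo_ball : ∀ l, Nonempty
    ((supp l : Set (EuclideanSpace ℝ (Fin d))) ≃ₜ closedBall (0 : EuclideanSpace ℝ (Fin d)) 1)
  origin_mem : ∀ l, (0 : EuclideanSpace ℝ (Fin d)) ∈ supp l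
  continuous_supp : Continuous supp

/-- A tile is a pair (label, position of the control point). This is its support. -/
def PrototileSet.tileSupp {d : ℕ} {L : Type*} [MetricSpace L] [CompactSpace L]
    (P : PrototileSet d L) (t : L × EuclideanSpace ℝ (Fin d)) : Set (EuclideanSpace ℝ (Fin d)) :=
  {y | y - t.2 ∈ P.supp t.1}

/-- A tiling of `ℝ^d`: a locally finite collection of tiles that covers `ℝ^d`, distinct tiles
meeting only on their boundaries. -/
@[ext]
structure Tiling {d : ℕ} {L : Type*} [MetricSpace L] [CompactSpace L]
    (P : PrototileSet d L) where
  tiles : Set (L × EuclideanSpace ℝ (Fin d))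
  cover : ∀ y, ∃ t ∈ tiles, y ∈ P.tileSupp t
  inter_subset : ∀ t ∈ tiles, ∀ t' ∈ tiles, t ≠ t' →
    P.tileSupp t ∩ P.tileSupp t' ⊆ frontier (P.tileSupp t) ∩ frontier (P.tileSupp t')
  locally_finite : ∀ r : ℝ, {t ∈ tiles | (P.tileSupp t ∩ closedBall 0 r).Nonempty}.Finite

namespace Tiling

variable {d : ℕ} {L : Type*} [MetricSpace L] [CompactSpace L] {P : PrototileSet d L}

theorem tileSupp_translate (x : EuclideanSpace ℝ (Fin d)) (t : L × EuclideanSpace ℝ (Fin d)) :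
    P.tileSupp (t.1, t.2 - x) = Homeomorph.addRight x ⁻¹' P.tileSupp t := by
  ext y
  have h : y - (t.2 - x) = y + x - t.2 := by abel
  simp [PrototileSet.tileSupp, h]

/-- The translated tiling `T - x`. -/
def translate (T : Tiling P) (x : EuclideanSpace ℝ (Fin d)) : Tiling P where
  tiles := (fun t => (t.1, t.2 - x)) '' T.tiles
  cover y := by
    obtain ⟨t, ht, hy⟩ := T.cover (y + x)
    exact ⟨_, ⟨t, ht, rfl⟩, by rw [tileSupp_translate]; exact hy⟩
  inter_subset := by
    rintro _ ⟨t, ht, rfl⟩ _ ⟨t', ht', rfl⟩ hne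
    have hne' : t ≠ t' := fun h => hne (by rw [h])
    simp only [tileSupp_translate, ← Homeomorph.preimage_frontier]
    exact fun y hy => T.inter_subset t ht t' ht' hne' hy
  locally_finite r := by
    refine ((T.locally_finite (r + ‖x‖)).image fun t => (t.1, t.2 - x)).subset ?_
    rintro _ ⟨⟨t, ht, rfl⟩, y, hy, hyr⟩
    rw [tileSupp_translate] at hy
    refine ⟨t, ⟨ht, y + x, hy, ?_⟩, rfl⟩
    rw [mem_closedBall_zero_iff] at hyr ⊢
    exact (norm_add_le y x).trans (by gcongr)

/-- `S` is the set of tiles of a finite patch of `T`. -/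
def IsPatch (T : Tiling P) (S : Set (L × EuclideanSpace ℝ (Fin d))) : Prop :=
  S ⊆ T.tiles ∧ S.Finite ∧ IsConnected (⋃ t ∈ S, P.tileSupp t)

/-- `T` and `T'` have patches containing the ball of radius `1/ε` about the origin that differ by
at most `ε`: their tiles correspond one to one, corresponding tiles being at most `ε` apart both
in the Hausdorff distance of their supports and in the distance of their labels. -/
def AgreeUpTo (T T' : Tiling P) (ε : ℝ) : Prop :=
  ∃ S S' : Set (L × EuclideanSpace ℝ (Fin d)), T.IsPatch S ∧ T'.IsPatch S' ∧
    closedBall 0 (1 / ε) ⊆ ⋃ t ∈ S, P.tileSupp t ∧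
    closedBall 0 (1 / ε) ⊆ ⋃ t ∈ S', P.tileSupp t ∧
    ∃ e : S ≃ S', ∀ t : S,
      hausdorffDist (P.tileSupp t.1) (P.tileSupp (e t).1) ≤ ε ∧ dist t.1.1 (e t).1.1 ≤ ε

/-- The distance between two tilings, capped at `1`. -/
noncomputable def tilingDist (T T' : Tiling P) : ℝ :=
  sInf ({ε : ℝ | 0 < ε ∧ ε ≤ 1 ∧ T.AgreeUpTo T' ε} ∪ {1})

/-- The topology of the tiling metric. -/
instance : TopologicalSpace (Tiling P) where
  IsOpen U := ∀ T ∈ U, ∃ ε > 0, ∀ T', T.tilingDist T' < ε → T' ∈ U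
  isOpen_univ := fun _ _ => ⟨1, one_pos, fun _ _ => mem_univ _⟩
  isOpen_inter := by
    rintro U V hU hV T ⟨hTU, hTV⟩
    obtain ⟨a, ha, hUa⟩ := hU T hTU
    obtain ⟨b, hb, hVb⟩ := hV T hTV
    exact ⟨min a b, lt_min ha hb, fun T' h =>
      ⟨hUa T' (h.trans_le (min_le_left _ _)), hVb T' (h.trans_le (min_le_right _ _))⟩⟩
  isOpen_sUnion := by
    rintro 𝒰 h𝒰 T ⟨U, hU, hT⟩
    obtain ⟨ε, hε, h⟩ := h𝒰 U hU T hT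
    exact ⟨ε, hε, fun T' hT' => ⟨U, hU, h T' hT'⟩⟩

/-- A tiling space: a closed, translation invariant set of tilings. -/
def IsTilingSpace (Ω : Set (Tiling P)) : Prop :=
  IsClosed Ω ∧ ∀ T ∈ Ω, ∀ x, T.translate x ∈ Ω

/-- The transversal: the tilings in `Ω` that have a control point at the origin. -/
def transversal (Ω : Set (Tiling P)) : Set (Tiling P) :=
  {T ∈ Ω | ∃ l : L, (l, 0) ∈ T.tiles}

/-- Expansive translational dynamics. -/
def IsExpansive (Ω : Set (Tiling P)) : Prop :=
  ∃ ε > 0, ∀ T ∈ Ω, ∀ T' ∈ Ω,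
    (∀ x, (T.translate x).tilingDist (T'.translate x) < ε) →
      ∃ y : EuclideanSpace ℝ (Fin d), ‖y‖ < ε ∧ T' = T.translate y

/-- Finite local complexity: up to translation, only finitely many pairs of touching tiles occur
in the tilings of `Ω`. (A tile is paired with itself as well, so there are finitely many tile
types.) A pair is recorded, up to translation, by its labels and its relative position. -/
def IsFLC (Ω : Set (Tiling P)) : Prop :=
  {q : L × L × EuclideanSpace ℝ (Fin d) | ∃ T ∈ Ω, ∃ t ∈ T.tiles, ∃ t' ∈ T.tiles,
    (P.tileSupp t ∩ P.tileSupp t').Nonempty ∧ q = (t.1, t'.1, t'.2 - t.2)}.Finite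

end Tiling

/-- The bonding map `ℝ/2^(k+1)ℤ → ℝ/2^kℤ`, induced by the identity of `ℝ`. -/
noncomputable def dyadicBond (k : ℕ) : AddCircle ((2 : ℝ) ^ (k + 1)) →+ AddCircle ((2 : ℝ) ^ k) :=
  QuotientAddGroup.map _ _ (AddMonoidHom.id ℝ) (by
    rw [AddSubgroup.zmultiples_le]
    exact ⟨2, by simp [pow_succ, mul_comm]⟩)

/-- The dyadic solenoid, the inverse limit of the circles `ℝ/2^kℤ`. -/
abbrev DyadicSolenoid : Type :=
  {x : ∀ k : ℕ, AddCircle ((2 : ℝ) ^ k) // ∀ k, dyadicBond k (x (k + 1)) = x k}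

/-- The labels of the stretched solenoid tiles. A pair `(2^(-n), s)` is the label of a tile of type
`A_n` and length `s`, and `(0, s)` that of a tile of type `A_∞` and length `s`. (For a `2`-adic
integer `q`, `‖q‖ = 2^(-n)` where `n` is the number of factors `2` in `q`.) -/
abbrev StretchedLabel (len : C(ℤ_[2], ℝ)) : Type :=
  range fun q : ℤ_[2] => ((‖q‖, len q) : ℝ × ℝ)

instance (len : C(ℤ_[2], ℝ)) : CompactSpace (StretchedLabel len) :=
  isCompact_iff_compactSpace.mp (isCompact_range (by fun_prop))

/-- The label carried by the tile at the point `q` of the odometer. -/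
noncomputable def stretchedLabel (len : C(ℤ_[2], ℝ)) (q : ℤ_[2]) : StretchedLabel len :=
  ⟨(‖q‖, len q), q, rfl⟩

theorem isometry_single_fin_one :
    Isometry fun r : ℝ => (EuclideanSpace.single 0 r : EuclideanSpace ℝ (Fin 1)) :=
  Isometry.of_dist_eq fun a b => by simp

/-- The closed interval `[0, s]` in the line. -/
noncomputable def interval (s : ℝ) (hs : 0 < s) :
    TopologicalSpace.NonemptyCompacts (EuclideanSpace ℝ (Fin 1)) where
  carrier := (fun r : ℝ => EuclideanSpace.single (0 : Fin 1) r) '' Icc 0 s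
  isCompact' := isCompact_Icc.image isometry_single_fin_one.continuous
  nonempty' := (nonempty_Icc.mpr hs.le).image _

theorem closedBall_fin_one : closedBall (0 : EuclideanSpace ℝ (Fin 1)) 1 =
    (fun r : ℝ => EuclideanSpace.single (0 : Fin 1) r) '' Icc (-1) 1 := by
  ext y
  have hy : y = EuclideanSpace.single (0 : Fin 1) (y 0) := by
    ext i
    rw [Subsingleton.elim i 0]
    simp
  rw [mem_closedBall_zero_iff]
  constructor
  · intro h
    refine ⟨y 0, ?_, hy.symm⟩
    rw [hy] at h
    simpa [abs_le] using h
  · rintro ⟨r, hr, rfl⟩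
    simpa [abs_le] using hr

theorem dist_interval_le (s t : ℝ) (hs : 0 < s) (ht : 0 < t) :
    dist (interval s hs) (interval t ht) ≤ |s - t| := by
  rw [Metric.NonemptyCompacts.dist_eq]
  change hausdorffDist ((fun r : ℝ => EuclideanSpace.single (0 : Fin 1) r) '' Icc 0 s)
    ((fun r : ℝ => EuclideanSpace.single (0 : Fin 1) r) '' Icc 0 t) ≤ _
  rw [hausdorffDist_image isometry_single_fin_one]
  have key : ∀ a b : ℝ, 0 < b → ∀ x ∈ Icc 0 a, ∃ y ∈ Icc 0 b, dist x y ≤ |a - b| := by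
    intro a b hb x hx
    refine ⟨min x b, ⟨le_min hx.1 hb.le, min_le_right _ _⟩, ?_⟩
    rw [Real.dist_eq]
    rcases le_total x b with h | h
    · simp [h]
    · rw [min_eq_right h, abs_of_nonneg (sub_nonneg.mpr h)]
      exact (sub_le_sub_right hx.2 b).trans (le_abs_self _)
  exact hausdorffDist_le_of_mem_dist (abs_nonneg _) (key s t ht)
    (by rw [abs_sub_comm]; exact key t s hs)

theorem stretchedLabel_pos (len : C(ℤ_[2], ℝ)) (hlen : ∀ q, 0 < len q) (l : StretchedLabel len) :
    0 < l.1.2 := by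
  obtain ⟨_, q, rfl⟩ := l
  exact hlen q

/-- The prototiles of the stretched solenoid: a tile whose label records the length `s` is the
interval `[0, s]`, with its left end point as control point. -/
noncomputable def stretchedPrototiles (len : C(ℤ_[2], ℝ)) (hlen : ∀ q, 0 < len q) :
    PrototileSet 1 (StretchedLabel len) where
  supp l := interval l.1.2 (stretchedLabel_pos len hlen l)
  homeo_ball l := by
    rw [closedBall_fin_one]
    have hemb := isometry_single_fin_one.isEmbedding
    exact ⟨(hemb.homeomorphImage (Icc 0 l.1.2)).symm.trans
      ((iccHomeoI 0 l.1.2 (stretchedLabel_pos len hlen l)).trans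
        ((iccHomeoI (-1) 1 (by norm_num)).symm.trans (hemb.homeomorphImage (Icc (-1) 1))))⟩
  origin_mem l := ⟨0, ⟨le_rfl, (stretchedLabel_pos len hlen l).le⟩, by simp⟩
  continuous_supp := by
    have : LipschitzWith 1 fun l : StretchedLabel len =>
        interval l.1.2 (stretchedLabel_pos len hlen l) :=
      LipschitzWith.of_dist_le_mul fun l l' => by
        refine (dist_interval_le _ _ _ _).trans ?_
        rw [NNReal.coe_one, one_mul, ← Real.dist_eq]
        exact le_max_right _ _
    exact this.continuous

/-- The dyadic solenoid tilings, stretched by `len`. For a `2`-adic integer `p`, the `i`-th tile is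
of type `A_n` where `n` is the number of factors `2` in `p + i` (so that, as in the dyadic
solenoid, every second tile is an `A_0`, every fourth tile is an `A_1`, and so on, and there may be
one `A_∞`, where `p + i = 0`). Its length is `len (p + i)`, and `e i` is its left end point. -/
def stretchedSolenoid (len : C(ℤ_[2], ℝ)) (hlen : ∀ q, 0 < len q) :
    Set (Tiling (stretchedPrototiles len hlen)) :=
  {T | ∃ (p : ℤ_[2]) (e : ℤ → ℝ), (∀ i, e (i + 1) = e i + len (p + i)) ∧
    T.tiles = range fun i : ℤ =>
      (stretchedLabel len (p + i), EuclideanSpace.single (0 : Fin 1) (e i))}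

/-!
The lengths are `stretch q = 1 + PadicInt.reversal q`, where `reversal` reads the binary expansion
of a `2`-adic integer backwards as a real number, so that `reversal (2 * r) = reversal r / 2` and
`reversal (2 * r + 1) = 1 + reversal r / 2`.

*Expansiveness.* The sum of `reversal` over the `2 ^ n` points of the odometer that start at
`2 ^ n * r` is `C + reversal r`, with `C` depending on `n` only (`exists_sum_reversal_eq`): the
fluctuations of the block lengths do not get smaller as `n` grows. If two tilings stay close under
all translations, then their tiles correspond in order and corresponding end points stay within
`1 / 4`. Let `p` and `p'` be the points of the odometer at corresponding tiles. If
`p' - p = 2 ^ n * u` with `u` odd, then the blocks of length `2 ^ n` starting where `p + i` is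
a multiple of `2 ^ (n + 2)` differ in length by at least `1 / 2`, a contradiction
(`exists_le_abs_sub_of_ne`). Hence `p = p'`, and the tilings are translates of each other.

*Topology.* The tiling space and the solenoid are both quotients of the product of `ℤ_[2]` with
`[0, 1]`: a pair `(p, t)` gives the tiling in which the origin divides the tile at `p` in the
proportion `t`, and the point of the solenoid at height `t` above `p`. The two maps identify the
same pairs (`proportionTiling_eq_iff`). That the first is a closed map, and that the tiling space is
closed, both come from `isClosed_image_odometerTiling`: compact sets of parameters give closed
sets of tilings. The transversal goes to the fibre of the solenoid over a point of the first circle.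

*Finite local complexity.* No tiling space of finite local complexity, whatever its dimension, is
homeomorphic to the dyadic solenoid (`Tiling.IsFLC.isEmpty_homeomorph`). On such a space every
continuous self-map that is uniformly close to the identity moves each tiling to a translate of
itself by a small vector (`Tiling.IsFLC.eq_translate_of_agreesOn`), because tilings that are close
agree exactly, up to a small translation, on a large ball. The solenoid, however, has translations
arbitrarily close to the identity, by `2 ^ n` along its flow, that are not small along any path: a
point is not joined to its image by a path of small diameter
(`DyadicSolenoid.exists_le_norm_sub`).
-/

/-! ### Tiles, patches and the tiling metric -/

section General

variable {d : ℕ} {L : Type*} [MetricSpace L] [CompactSpace L] {P : PrototileSet d L}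

theorem PrototileSet.tileSupp_eq_preimage (P : PrototileSet d L)
    (t : L × EuclideanSpace ℝ (Fin d)) :
    P.tileSupp t = Homeomorph.addRight (-t.2) ⁻¹' (P.supp t.1) := by
  ext y
  simp [PrototileSet.tileSupp, sub_eq_add_neg]

theorem PrototileSet.tileSupp_eq_image (P : PrototileSet d L)
    (t : L × EuclideanSpace ℝ (Fin d)) :
    P.tileSupp t = Homeomorph.addRight t.2 '' (P.supp t.1) := by
  rw [P.tileSupp_eq_preimage, Homeomorph.image_eq_preimage_symm]
  rfl

theorem PrototileSet.isCompact_tileSupp (P : PrototileSet d L)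
    (t : L × EuclideanSpace ℝ (Fin d)) : IsCompact (P.tileSupp t) := by
  rw [P.tileSupp_eq_image]
  exact (P.supp t.1).isCompact.image (Homeomorph.continuous _)

theorem PrototileSet.isClosed_tileSupp (P : PrototileSet d L)
    (t : L × EuclideanSpace ℝ (Fin d)) : IsClosed (P.tileSupp t) :=
  (P.isCompact_tileSupp t).isClosed

theorem PrototileSet.controlPoint_mem (P : PrototileSet d L)
    (t : L × EuclideanSpace ℝ (Fin d)) : t.2 ∈ P.tileSupp t := by
  change t.2 - t.2 ∈ P.supp t.1
  rw [sub_self]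
  exact P.origin_mem t.1

theorem PrototileSet.isPreconnected_tileSupp (P : PrototileSet d L)
    (t : L × EuclideanSpace ℝ (Fin d)) : IsPreconnected (P.tileSupp t) := by
  rw [P.tileSupp_eq_image]
  refine IsPreconnected.image ?_ _ (Homeomorph.continuous _).continuousOn
  obtain ⟨e⟩ := P.homeo_ball t.1
  have : PreconnectedSpace (closedBall (0 : EuclideanSpace ℝ (Fin d)) 1) :=
    isPreconnected_iff_preconnectedSpace.mp (convex_closedBall _ _).isPreconnected
  exact isPreconnected_iff_preconnectedSpace.mpr
    (e.symm.surjective.denseRange.preconnectedSpace e.symm.continuous)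

theorem PrototileSet.mem_tileSupp_add (P : PrototileSet d L)
    {l : L} {x v y : EuclideanSpace ℝ (Fin d)} :
    y ∈ P.tileSupp (l, x + v) ↔ y - v ∈ P.tileSupp (l, x) := by
  simp only [PrototileSet.tileSupp, mem_ofPred_eq]
  rw [sub_sub, add_comm]

theorem PrototileSet.mem_interior_tileSupp_add (P : PrototileSet d L)
    {l : L} {x v y : EuclideanSpace ℝ (Fin d)} :
    y ∈ interior (P.tileSupp (l, x + v)) ↔ y - v ∈ interior (P.tileSupp (l, x)) := by
  have : P.tileSupp (l, x + v) = Homeomorph.addRight (-v) ⁻¹' P.tileSupp (l, x) := by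
    ext z
    rw [P.mem_tileSupp_add]
    simp [sub_eq_add_neg]
  rw [this, ← Homeomorph.preimage_interior]
  simp [sub_eq_add_neg]

/-- A translation by `v` moves a compact set by Hausdorff distance at least `‖v‖`: compare the
points of both sets that are extreme in the direction of `v`. -/
theorem PrototileSet.norm_sub_le_hausdorffDist (P : PrototileSet d L)
    (l : L) (x x' : EuclideanSpace ℝ (Fin d)) :
    ‖x' - x‖ ≤ hausdorffDist (P.tileSupp (l, x)) (P.tileSupp (l, x')) := by
  set v := x' - x with hv
  have hx' : x' = x + v := by rw [hv]; abel
  rw [hx']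
  obtain ⟨a, ha, hmax⟩ := (P.isCompact_tileSupp (l, x)).exists_isMaxOn
    ⟨_, P.controlPoint_mem (l, x)⟩
    (f := fun y => inner ℝ v y) (by fun_prop)
  refine le_of_forall_gt fun r hr => ?_
  obtain ⟨y, hy, hyr⟩ := exists_dist_lt_of_hausdorffDist_lt' (y := a + v)
    (P.mem_tileSupp_add.mpr (by simpa using ha)) hr
    (hausdorffEDist_ne_top_of_nonempty_of_bounded ⟨_, P.controlPoint_mem _⟩
      ⟨_, P.controlPoint_mem _⟩ (P.isCompact_tileSupp _).isBounded
      (P.isCompact_tileSupp _).isBounded)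
  have h1 : inner ℝ v y ≤ inner ℝ v a := hmax hy
  have h2 : inner ℝ v (a + v - y) ≤ ‖v‖ * ‖a + v - y‖ := real_inner_le_norm _ _
  rw [inner_sub_right, inner_add_right, real_inner_self_eq_norm_sq] at h2
  rw [dist_eq_norm, norm_sub_rev] at hyr
  by_contra! hle
  have hpos : 0 < ‖v‖ := by
    refine lt_of_lt_of_le ?_ hle
    exact lt_of_le_of_lt (norm_nonneg _) hyr
  nlinarith

theorem Set.Finite.exists_pos_forall_eq_of_dist_lt {X : Type*} [MetricSpace X] {s : Set X}
    (hs : s.Finite) : ∃ γ > 0, ∀ a ∈ s, ∀ b ∈ s, dist a b < γ → a = b := by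
  have : ∀ᶠ γ : ℝ in 𝓝[>] 0, ∀ a ∈ s, ∀ b ∈ s, dist a b < γ → a = b := by
    rw [Filter.eventually_all_finite hs]
    refine fun a _ => (Filter.eventually_all_finite hs).mpr fun b _ => ?_
    by_cases hab : a = b
    · simp [hab]
    · filter_upwards [Ioo_mem_nhdsGT (dist_pos.mpr hab)] with γ hγ h
      exact absurd h (not_lt.mpr hγ.2.le)
  obtain ⟨γ, h, hγ⟩ := (this.and self_mem_nhdsWithin).exists
  exact ⟨γ, hγ, h⟩

namespace Tiling

theorem tilingDist_le {T T' : Tiling P} {ε : ℝ} (h0 : 0 < ε) (h1 : ε ≤ 1)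
    (h : T.AgreeUpTo T' ε) : T.tilingDist T' ≤ ε := by
  refine csInf_le ⟨0, ?_⟩ (Or.inl ⟨h0, h1, h⟩)
  rintro x (hx | rfl)
  · exact hx.1.le
  · exact zero_le_one

theorem exists_agreeUpTo_of_tilingDist_lt {T T' : Tiling P} {ε : ℝ} (h1 : ε ≤ 1)
    (h : T.tilingDist T' < ε) : ∃ δ, 0 < δ ∧ δ < ε ∧ T.AgreeUpTo T' δ := by
  obtain ⟨δ, hδ | rfl, hδε⟩ := exists_lt_of_csInf_lt (by exact ⟨1, Or.inr rfl⟩) h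
  · exact ⟨δ, hδ.1, hδε, hδ.2.2⟩
  · exact absurd hδε (not_lt.mpr h1)

theorem AgreeUpTo.symm {T T' : Tiling P} {ε : ℝ} (h : T.AgreeUpTo T' ε) :
    T'.AgreeUpTo T ε := by
  obtain ⟨S, S', hS, hS', hc, hc', e, he⟩ := h
  refine ⟨S', S, hS', hS, hc', hc, e.symm, fun t => ?_⟩
  have := he (e.symm t)
  rw [Equiv.apply_symm_apply] at this
  rwa [hausdorffDist_comm, dist_comm]

/-- A correspondence of patches can be given by two injective families with the same indices. -/
theorem agreeUpTo_of_injOn {ι : Type*} {I : Set ι} {f f' : ι → L × EuclideanSpace ℝ (Fin d)}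
    {T T' : Tiling P} {ε : ℝ} (hf : InjOn f I) (hf' : InjOn f' I)
    (hp : T.IsPatch (f '' I)) (hp' : T'.IsPatch (f' '' I))
    (hc : closedBall 0 (1 / ε) ⊆ ⋃ t ∈ f '' I, P.tileSupp t)
    (hc' : closedBall 0 (1 / ε) ⊆ ⋃ t ∈ f' '' I, P.tileSupp t)
    (h : ∀ i ∈ I, hausdorffDist (P.tileSupp (f i)) (P.tileSupp (f' i)) ≤ ε ∧
      dist (f i).1 (f' i).1 ≤ ε) : T.AgreeUpTo T' ε := by
  refine ⟨_, _, hp, hp', hc, hc', (Equiv.Set.imageOfInjOn f I hf).symm.trans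
    (Equiv.Set.imageOfInjOn f' I hf'), ?_⟩
  intro t
  obtain ⟨i, rfl⟩ := (Equiv.Set.imageOfInjOn f I hf).surjective t
  rw [Equiv.trans_apply, Equiv.symm_apply_apply]
  exact h i i.2

/-- Tiles that cover a ball and meet it form a patch: their union is connected because each of
them is attached to the ball. -/
theorem isPatch_of_cover {T : Tiling P} {S : Set (L × EuclideanSpace ℝ (Fin d))} {r : ℝ}
    (hr : 0 ≤ r) (hS : S ⊆ T.tiles) (hmeet : ∀ t ∈ S, (P.tileSupp t ∩ closedBall 0 r).Nonempty)
    (hc : closedBall 0 r ⊆ ⋃ t ∈ S, P.tileSupp t) : T.IsPatch S := by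
  have h0 : (0 : EuclideanSpace ℝ (Fin d)) ∈ closedBall 0 r := mem_closedBall_self hr
  refine ⟨hS, (T.locally_finite r).subset fun t ht => ⟨hS ht, hmeet t ht⟩, ⟨0, hc h0⟩, ?_⟩
  refine isPreconnected_of_forall 0 fun y hy => ?_
  obtain ⟨t, ht, hyt⟩ := mem_iUnion₂.mp hy
  obtain ⟨z, hzt, hz⟩ := hmeet t ht
  exact ⟨P.tileSupp t ∪ closedBall 0 r,
    union_subset (subset_biUnion_of_mem (u := fun t => P.tileSupp t) ht) hc, Or.inr h0, Or.inl hyt,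
    (P.isPreconnected_tileSupp t).union z hzt hz (convex_closedBall _ _).isPreconnected⟩

/-- A set of tiles covering an interior point of a tile contains that tile. -/
theorem mem_of_mem_interior {T : Tiling P} {S : Set (L × EuclideanSpace ℝ (Fin d))}
    (hS : S ⊆ T.tiles) {t : L × EuclideanSpace ℝ (Fin d)} (ht : t ∈ T.tiles)
    {y : EuclideanSpace ℝ (Fin d)} (hy : y ∈ interior (P.tileSupp t))
    (hyS : y ∈ ⋃ t ∈ S, P.tileSupp t) : t ∈ S := by
  obtain ⟨s, hs, hys⟩ := mem_iUnion₂.mp hyS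
  by_cases hst : t = s
  · rwa [hst]
  · exact absurd hy ((T.inter_subset t ht s (hS hs) hst ⟨interior_subset hy, hys⟩).1).2

theorem AgreeUpTo.exists_corresponding {T T' : Tiling P} {δ : ℝ} (h : T.AgreeUpTo T' δ)
    {t : L × EuclideanSpace ℝ (Fin d)} (ht : t ∈ T.tiles) {y : EuclideanSpace ℝ (Fin d)}
    (hy : y ∈ interior (P.tileSupp t)) (hyδ : ‖y‖ ≤ 1 / δ) :
    ∃ t' ∈ T'.tiles, hausdorffDist (P.tileSupp t) (P.tileSupp t') ≤ δ ∧ dist t.1 t'.1 ≤ δ := by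
  obtain ⟨S, S', hS, hS', hc, -, e, he⟩ := h
  have htS := mem_of_mem_interior hS.1 ht hy (hc (mem_closedBall_zero_iff.mpr hyδ))
  exact ⟨_, hS'.1 (e ⟨t, htS⟩).2, he ⟨t, htS⟩⟩

theorem mem_translate {T : Tiling P} {x : EuclideanSpace ℝ (Fin d)}
    {t : L × EuclideanSpace ℝ (Fin d)} :
    t ∈ (T.translate x).tiles ↔ (t.1, t.2 + x) ∈ T.tiles := by
  constructor
  · rintro ⟨s, hs, rfl⟩
    simpa using hs
  · intro h
    exact ⟨_, h, by simp⟩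

theorem translate_translate (T : Tiling P) (x y : EuclideanSpace ℝ (Fin d)) :
    (T.translate x).translate y = T.translate (x + y) := by
  ext t
  simp only [mem_translate]
  rw [add_assoc, add_comm y]

theorem translate_zero (T : Tiling P) : T.translate 0 = T := by
  ext t
  simp [mem_translate]

theorem agreeUpTo_translate (T : Tiling P) {u : EuclideanSpace ℝ (Fin d)} {ε : ℝ} (h0 : 0 < ε)
    (hu : ‖u‖ ≤ ε) : T.AgreeUpTo (T.translate u) ε := by
  have hr : 0 ≤ 1 / ε := by positivity
  set I := {t ∈ T.tiles | (P.tileSupp t ∩ closedBall 0 (1 / ε + ‖u‖)).Nonempty} with hI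
  have hcov : closedBall 0 (1 / ε + ‖u‖) ⊆ ⋃ t ∈ I, P.tileSupp t := fun y hy => by
    obtain ⟨t, ht, hyt⟩ := T.cover y
    exact mem_iUnion₂.mpr ⟨t, ⟨ht, y, hyt, hy⟩, hyt⟩
  have hp : T.IsPatch I := isPatch_of_cover (by positivity) (fun t ht => ht.1) (fun t ht => ht.2)
    hcov
  have hU : ⋃ t ∈ (fun t => (t.1, t.2 - u)) '' I, P.tileSupp t =
      Homeomorph.addRight u ⁻¹' ⋃ t ∈ I, P.tileSupp t := by
    rw [biUnion_image]
    simp only [tileSupp_translate, preimage_iUnion]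
  refine agreeUpTo_of_injOn (I := I) (f := id) (f' := fun t => (t.1, t.2 - u))
    (injOn_id _) (fun a _ b _ h => ?_) ?_ ?_ ?_ ?_ ?_
  · simp only [Prod.mk.injEq, sub_left_inj] at h
    exact Prod.ext h.1 h.2
  · rwa [image_id]
  · refine ⟨image_mono hp.1, hp.2.1.image _, ?_⟩
    rw [hU]
    exact (Homeomorph.isConnected_preimage _).mpr hp.2.2
  · rw [image_id]
    exact (closedBall_subset_closedBall (by linarith [norm_nonneg u])).trans hcov
  · rw [hU]
    intro y hy
    refine hcov ?_
    rw [mem_closedBall_zero_iff] at hy ⊢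
    exact (norm_add_le y u).trans (by gcongr)
  · intro t _
    refine ⟨hausdorffDist_le_of_mem_dist h0.le (fun y hy => ⟨y - u, ?_, ?_⟩)
      (fun y hy => ⟨y + u, ?_, ?_⟩), by simpa using h0.le⟩
    · rw [tileSupp_translate]
      simpa using hy
    · simpa [dist_eq_norm] using hu
    · rw [tileSupp_translate] at hy
      exact hy
    · simpa [dist_eq_norm] using hu

theorem continuous_of_tilingDist {X : Type*} [TopologicalSpace X] {f : X → Tiling P}
    (h : ∀ x, ∀ ε > 0, ∀ᶠ x' in 𝓝 x, (f x).tilingDist (f x') < ε) : Continuous f := by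
  refine continuous_def.mpr fun U hU => isOpen_iff_mem_nhds.mpr fun x hx => ?_
  obtain ⟨ε, hε, hεU⟩ := hU (f x) hx
  exact (h x ε hε).mono fun x' hx' => hεU _ hx'

theorem continuous_translate (T : Tiling P) : Continuous T.translate := by
  refine continuous_of_tilingDist fun x ε hε => ?_
  have h0 : 0 < min (ε / 2) 1 := by positivity
  filter_upwards [ball_mem_nhds x h0] with x' hx'
  have : T.translate x' = (T.translate x).translate (x' - x) := by
    rw [translate_translate, add_sub_cancel]
  rw [this]
  refine (tilingDist_le h0 (min_le_right _ _) (agreeUpTo_translate _ h0 ?_)).trans_lt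
    ((min_le_left _ _).trans_lt (half_lt_self hε))
  rw [← dist_eq_norm]
  exact hx'.le

/-! ### Fat tiles -/

/-- The tiles with nonempty interior are dense, by Baire's theorem. (That every tile has nonempty
interior would need invariance of domain; the argument is arranged to do without it.) -/
theorem dense_biUnion_interior (T : Tiling P) :
    Dense (⋃ t ∈ T.tiles, interior (P.tileSupp t)) := by
  refine dense_biUnion_interior_of_closed (fun t _ => P.isClosed_tileSupp t) ?_ ?_
  · have : T.tiles ⊆ ⋃ n : ℕ, {t ∈ T.tiles | (P.tileSupp t ∩ closedBall 0 n).Nonempty} := by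
      intro t ht
      obtain ⟨n, hn⟩ := exists_nat_ge ‖t.2‖
      exact mem_iUnion.mpr ⟨n, ht, t.2, P.controlPoint_mem t, by simpa using hn⟩
    exact (countable_iUnion fun n : ℕ => (T.locally_finite n).countable).mono this
  · exact eq_univ_of_forall fun y => by
      obtain ⟨t, ht, hy⟩ := T.cover y
      exact mem_iUnion₂.mpr ⟨t, ht, hy⟩

theorem exists_mem_interior_inter_ball (T : Tiling P) (x : EuclideanSpace ℝ (Fin d)) {r : ℝ}
    (hr : 0 < r) : ∃ t ∈ T.tiles, (interior (P.tileSupp t) ∩ ball x r).Nonempty := by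
  obtain ⟨y, hy, hyr⟩ := T.dense_biUnion_interior.exists_dist_lt x hr
  obtain ⟨t, ht, hyt⟩ := mem_iUnion₂.mp hy
  exact ⟨t, ht, y, hyt, by rwa [mem_ball, dist_comm]⟩

/-- The tiles with nonempty interior cover the space. -/
theorem exists_fat_mem (T : Tiling P) (y : EuclideanSpace ℝ (Fin d)) :
    ∃ t ∈ T.tiles, (interior (P.tileSupp t)).Nonempty ∧ y ∈ P.tileSupp t := by
  set F := {t ∈ T.tiles | (P.tileSupp t ∩ closedBall 0 (‖y‖ + 1)).Nonempty} ∩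
    {t | (interior (P.tileSupp t)).Nonempty} with hF
  have hfin : F.Finite := (T.locally_finite _).inter_of_left _
  have hcl : IsClosed (⋃ t ∈ F, P.tileSupp t) :=
    hfin.isClosed_biUnion fun t _ => P.isClosed_tileSupp t
  have hy : y ∈ ⋃ t ∈ F, P.tileSupp t := by
    rw [← hcl.closure_eq, Metric.mem_closure_iff]
    intro ε hε
    obtain ⟨t, ht, z, hz, hzy⟩ := T.exists_mem_interior_inter_ball y (lt_min hε one_pos)
    rw [mem_ball, dist_comm] at hzy
    refine ⟨z, mem_iUnion₂.mpr ⟨t, ⟨⟨ht, z, interior_subset hz, ?_⟩, z, hz⟩, interior_subset hz⟩,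
      hzy.trans_le (min_le_left _ _)⟩
    rw [mem_closedBall_zero_iff]
    have h1 : ‖z‖ ≤ ‖y‖ + ‖y - z‖ := by
      have := norm_sub_le y (y - z)
      rwa [sub_sub_cancel] at this
    rw [← dist_eq_norm] at h1
    linarith [hzy.trans_le (min_le_right _ _)]
  obtain ⟨t, ht, hyt⟩ := mem_iUnion₂.mp hy
  exact ⟨t, ht.1.1, ht.2, hyt⟩

/-- Tilings with the same fat tiles are not told apart by the topology of the tiling metric. -/
theorem inseparable_of_fat {T T' : Tiling P}
    (h : ∀ t, (interior (P.tileSupp t)).Nonempty → (t ∈ T.tiles ↔ t ∈ T'.tiles)) :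
    Inseparable T T' := by
  have key : ∀ T T' : Tiling P,
      (∀ t, (interior (P.tileSupp t)).Nonempty → (t ∈ T.tiles ↔ t ∈ T'.tiles)) →
      ∀ U : Set (Tiling P), IsOpen U → T ∈ U → T' ∈ U := by
    intro T T' h U hU hT
    obtain ⟨ε, hε, hεU⟩ := hU T hT
    refine hεU T' ?_
    have h0 : 0 < min (ε / 2) 1 := by positivity
    refine (tilingDist_le h0 (min_le_right _ _) ?_).trans_lt
      ((min_le_left _ _).trans_lt (half_lt_self hε))
    set δ := min (ε / 2) 1
    have hr : 0 ≤ 1 / δ := by positivity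
    set S := {t ∈ T.tiles | (interior (P.tileSupp t)).Nonempty ∧
      (P.tileSupp t ∩ closedBall 0 (1 / δ)).Nonempty}
    have hc : closedBall 0 (1 / δ) ⊆ ⋃ t ∈ S, P.tileSupp t := fun y hy => by
      obtain ⟨t, ht, hfat, hyt⟩ := T.exists_fat_mem y
      exact mem_iUnion₂.mpr ⟨t, ⟨ht, hfat, y, hyt, hy⟩, hyt⟩
    exact ⟨S, S, isPatch_of_cover hr (fun t ht => ht.1) (fun t ht => ht.2.2) hc,
      isPatch_of_cover hr (fun t ht => (h t ht.2.1).mp ht.1) (fun t ht => ht.2.2) hc,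
      hc, hc, Equiv.refl _, fun t => by simpa using h0.le⟩
  exact inseparable_iff_forall_isOpen.mpr fun U hU =>
    ⟨key T T' h U hU, key T' T (fun t ht => (h t ht).symm) U hU⟩

/-- `T` and `T'` have the same tiles among those whose interior meets `U`. -/
def AgreesOn (T T' : Tiling P) (U : Set (EuclideanSpace ℝ (Fin d))) : Prop :=
  ∀ t, (interior (P.tileSupp t) ∩ U).Nonempty → (t ∈ T.tiles ↔ t ∈ T'.tiles)

theorem AgreesOn.symm {T T' : Tiling P} {U : Set (EuclideanSpace ℝ (Fin d))}
    (h : T.AgreesOn T' U) : T'.AgreesOn T U :=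
  fun t ht => (h t ht).symm

theorem AgreesOn.trans {T T' T'' : Tiling P} {U : Set (EuclideanSpace ℝ (Fin d))}
    (h : T.AgreesOn T' U) (h' : T'.AgreesOn T'' U) : T.AgreesOn T'' U :=
  fun t ht => (h t ht).trans (h' t ht)

theorem AgreesOn.mono {T T' : Tiling P} {U V : Set (EuclideanSpace ℝ (Fin d))}
    (h : T.AgreesOn T' U) (hVU : V ⊆ U) : T.AgreesOn T' V :=
  fun t ht => h t (ht.mono (inter_subset_inter_right _ hVU))

theorem AgreesOn.translate {T T' : Tiling P} {x y : EuclideanSpace ℝ (Fin d)} {r s : ℝ}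
    (h : T.AgreesOn T' (ball y r)) {c : EuclideanSpace ℝ (Fin d)}
    (hc : ‖c + x - y‖ + s ≤ r) :
    (T.translate x).AgreesOn (T'.translate x) (ball c s) := by
  rintro t ⟨z, hz, hzc⟩
  simp only [mem_translate]
  refine h _ ⟨z + x, ?_, ?_⟩
  · rw [P.mem_interior_tileSupp_add]
    simpa using hz
  · rw [mem_ball, dist_eq_norm] at hzc ⊢
    have : z + x - y = (z - c) + (c + x - y) := by abel
    rw [this]
    exact (norm_add_le _ _).trans_lt (by linarith)

end Tiling

end General

/-! ### Rigidity of tilings of finite local complexity -/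

section FLC

variable {d : ℕ} {L : Type*} [MetricSpace L] [CompactSpace L] {P : PrototileSet d L}

namespace Tiling

theorem IsFLC.finite_labels {Ω : Set (Tiling P)} (h : IsFLC Ω) :
    {l | ∃ T ∈ Ω, ∃ t ∈ T.tiles, t.1 = l}.Finite := by
  refine (h.image Prod.fst).subset ?_
  rintro l ⟨T, hT, t, ht, rfl⟩
  exact ⟨(t.1, t.1, t.2 - t.2), ⟨T, hT, t, ht, t, ht,
    ⟨t.2, P.controlPoint_mem t, P.controlPoint_mem t⟩, rfl⟩, rfl⟩

/-- Under finite local complexity, a fat tile and a different translate of it by a uniformly small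
vector do not occur in the same tiling, since their interiors would overlap. -/
theorem IsFLC.exists_separation {Ω : Set (Tiling P)} (h : IsFLC Ω) :
    ∃ r > 0, ∀ T ∈ Ω, ∀ t ∈ T.tiles, (interior (P.tileSupp t)).Nonempty →
      ∀ w, ‖w‖ < r → (t.1, t.2 + w) ∈ T.tiles → w = 0 := by
  have key : ∀ᶠ r : ℝ in 𝓝[>] 0, ∀ l ∈ {l | ∃ T ∈ Ω, ∃ t ∈ T.tiles, t.1 = l},
      (interior (P.tileSupp (l, 0))).Nonempty → ∃ c, ball c r ⊆ P.tileSupp (l, 0) := by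
    refine (Filter.eventually_all_finite h.finite_labels).mpr fun l _ => ?_
    by_cases hl : (interior (P.tileSupp (l, 0))).Nonempty
    · obtain ⟨c, hc⟩ := hl
      obtain ⟨r, hr, hrc⟩ := Metric.mem_nhds_iff.mp (mem_interior_iff_mem_nhds.mp hc)
      filter_upwards [Ioo_mem_nhdsGT hr] with s hs _
      exact ⟨c, (ball_subset_ball hs.2.le).trans hrc⟩
    · exact Filter.Eventually.of_forall fun _ h' => absurd h' hl
  obtain ⟨r, hrl, hr⟩ := (key.and self_mem_nhdsWithin).exists
  refine ⟨r, hr, fun T hT t ht hfat w hw hw' => ?_⟩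
  obtain ⟨y, hy⟩ := hfat
  have hy' : y - t.2 ∈ interior (P.tileSupp (t.1, 0)) := by
    rw [← P.mem_interior_tileSupp_add, zero_add]
    exact hy
  obtain ⟨c, hc⟩ := hrl t.1 ⟨T, hT, t, ht, rfl⟩ ⟨_, hy'⟩
  by_contra hne
  have hne' : t ≠ (t.1, t.2 + w) := fun h => hne (by simpa using (congrArg Prod.snd h).symm)
  have hc1 : c + t.2 ∈ interior (P.tileSupp t) := by
    have h0 : c ∈ interior (P.tileSupp (t.1, 0)) :=
      interior_mono hc (by rw [isOpen_ball.interior_eq]; exact mem_ball_self hr)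
    have := (P.mem_interior_tileSupp_add (l := t.1) (x := 0) (v := t.2) (y := c + t.2)).mpr
      (by simpa using h0)
    rwa [zero_add] at this
  have hc2 : c + t.2 ∈ P.tileSupp (t.1, t.2 + w) := by
    have : P.tileSupp (t.1, t.2 + w) = P.tileSupp (t.1, 0 + (t.2 + w)) := by rw [zero_add]
    rw [this, P.mem_tileSupp_add]
    refine hc ?_
    have h2 : c + t.2 - (t.2 + w) - c = -w := by abel
    rwa [mem_ball, dist_eq_norm, h2, norm_neg]
  exact (T.inter_subset t ht _ hw' hne' ⟨interior_subset hc1, hc2⟩).1.2 hc1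

/-- Disjoint tiles of a single tiling that meet a given ball stay a definite distance apart. -/
theorem exists_gap (T : Tiling P) (r : ℝ) : ∃ ρ > 0,
    ∀ t ∈ {t ∈ T.tiles | (P.tileSupp t ∩ closedBall 0 r).Nonempty},
    ∀ s ∈ {t ∈ T.tiles | (P.tileSupp t ∩ closedBall 0 r).Nonempty},
    ∀ x ∈ P.tileSupp t, ∀ y ∈ P.tileSupp s, dist x y < ρ →
      (P.tileSupp t ∩ P.tileSupp s).Nonempty := by
  have key : ∀ᶠ ρ : ℝ in 𝓝[>] 0,
      ∀ t ∈ {t ∈ T.tiles | (P.tileSupp t ∩ closedBall 0 r).Nonempty},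
      ∀ s ∈ {t ∈ T.tiles | (P.tileSupp t ∩ closedBall 0 r).Nonempty},
      ∀ x ∈ P.tileSupp t, ∀ y ∈ P.tileSupp s, dist x y < ρ →
        (P.tileSupp t ∩ P.tileSupp s).Nonempty := by
    refine (Filter.eventually_all_finite (T.locally_finite r)).mpr fun t _ =>
      (Filter.eventually_all_finite (T.locally_finite r)).mpr fun s _ => ?_
    by_cases hts : (P.tileSupp t ∩ P.tileSupp s).Nonempty
    · exact Filter.Eventually.of_forall fun _ _ _ _ _ _ => hts
    · obtain ⟨ρ, hρ, h⟩ := exists_pos_forall_lt_edist (P.isCompact_tileSupp t)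
        (P.isClosed_tileSupp s) (disjoint_iff_inter_eq_empty.mpr (not_nonempty_iff_eq_empty.mp hts))
      filter_upwards [Ioo_mem_nhdsGT (NNReal.coe_pos.mpr hρ)] with ρ' hρ' x hx y hy hxy
      have h1 := h x hx y hy
      rw [edist_nndist, ENNReal.coe_lt_coe, ← NNReal.coe_lt_coe, coe_nndist] at h1
      exact absurd (hxy.trans hρ'.2) (not_lt.mpr h1.le)
  obtain ⟨ρ, h, hρ⟩ := (key.and self_mem_nhdsWithin).exists
  exact ⟨ρ, hρ, h⟩

/-- Under finite local complexity, a tiling that is close enough to `T` in the tiling metric agrees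
on a given ball with a small translate of `T`. Corresponding tiles are translates of each other; if
two tiles of `T'` touch, then so do the corresponding tiles of `T`, hence by finite local
complexity both pairs are translates of each other, and the translation vector propagates over the
ball by connectedness. -/
theorem IsFLC.exists_forall_tilingDist_lt {Ω : Set (Tiling P)} (h : IsFLC Ω) {T : Tiling P}
    (hT : T ∈ Ω) {M η : ℝ} (hM : 0 < M) (hη : 0 < η) :
    ∃ ε > 0, ∀ T' ∈ Ω, T.tilingDist T' < ε →
      ∃ u, ‖u‖ < η ∧ T'.AgreesOn (T.translate u) (ball 0 M) := by
  obtain ⟨γ, hγ, hγF⟩ := h.exists_pos_forall_eq_of_dist_lt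
  obtain ⟨κ, hκ, hκF⟩ := h.finite_labels.exists_pos_forall_eq_of_dist_lt
  obtain ⟨ρ, hρ, hgap⟩ := T.exists_gap (M + 2)
  refine ⟨min (min (min (1 / (M + 1)) (1 / 4)) (min (γ / 2) (ρ / 2))) (min κ η),
    by positivity, fun T' hT' hd => ?_⟩
  obtain ⟨δ, hδ, hδε, S, S', hS, hS', hc, hc', e, he⟩ := exists_agreeUpTo_of_tilingDist_lt
    ((min_le_left _ _).trans ((min_le_left _ _).trans ((min_le_right _ _).trans (by norm_num)))) hd
  simp only [lt_min_iff] at hδε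
  obtain ⟨⟨⟨hδM, hδ4⟩, hδγ, hδρ⟩, hδκ, hδη⟩ := hδε
  have hMδ : M + 1 < 1 / δ := by
    rw [lt_div_iff₀ (by positivity)] at hδM ⊢
    linarith
  have hlab : ∀ t : S, (e t).1.1 = t.1.1 := fun t =>
    (hκF _ ⟨T, hT, t.1, hS.1 t.2, rfl⟩ _ ⟨T', hT', (e t).1, hS'.1 (e t).2, rfl⟩
      ((he t).2.trans_lt hδκ)).symm
  -- The displacement of the tile corresponding to `t`.
  set v : S → EuclideanSpace ℝ (Fin d) := fun t => (e t).1.2 - t.1.2 with hv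
  have hev : ∀ t : S, (e t).1 = (t.1.1, t.1.2 + v t) := fun t =>
    Prod.ext (hlab t) (by simp [hv])
  have hvδ : ∀ t : S, ‖v t‖ ≤ δ := fun t => by
    have h1 := P.norm_sub_le_hausdorffDist t.1.1 t.1.2 (t.1.2 + v t)
    rw [add_sub_cancel_left, ← hev t] at h1
    exact h1.trans (he t).1
  have hmem : ∀ (t : S) (y : EuclideanSpace ℝ (Fin d)), y ∈ P.tileSupp (e t).1 ↔
      y - v t ∈ P.tileSupp t.1 := fun t y => by rw [hev t, P.mem_tileSupp_add]
  have hA : ∀ (t : S) (y : EuclideanSpace ℝ (Fin d)), y ∈ P.tileSupp (e t).1 →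
      y ∈ closedBall 0 (M + 1) →
      t.1 ∈ {t ∈ T.tiles | (P.tileSupp t ∩ closedBall 0 (M + 2)).Nonempty} := by
    intro t y hy hyM
    refine ⟨hS.1 t.2, y - v t, (hmem t y).mp hy, ?_⟩
    rw [mem_closedBall_zero_iff] at hyM ⊢
    linarith [norm_sub_le y (v t), hvδ t]
  have hball0 : (0 : EuclideanSpace ℝ (Fin d)) ∈ closedBall 0 (M + 1) :=
    mem_closedBall_self (by positivity)
  have hcov : ∀ y ∈ closedBall (0 : EuclideanSpace ℝ (Fin d)) (M + 1),
      ∃ t : S, y ∈ P.tileSupp (e t).1 := by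
    intro y hy
    obtain ⟨s, hs, hys⟩ := mem_iUnion₂.mp (hc' (closedBall_subset_closedBall hMδ.le hy))
    exact ⟨e.symm ⟨s, hs⟩, by rwa [Equiv.apply_symm_apply]⟩
  obtain ⟨t₀, ht₀⟩ := hcov 0 hball0
  have hconst : ∀ t : S, (P.tileSupp (e t).1 ∩ closedBall 0 (M + 1)).Nonempty → v t = v t₀ := by
    intro t ht
    by_contra hne
    have : Finite S := hS.2.1
    have hcl : ∀ Q : S → Prop, IsClosed (⋃ t : {t : S // Q t}, P.tileSupp (e t.1).1) := fun Q =>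
      isClosed_iUnion_of_finite fun t => P.isClosed_tileSupp _
    obtain ⟨y, hyM, hy1, hy2⟩ := isPreconnected_closed_iff.mp
      (convex_closedBall (0 : EuclideanSpace ℝ (Fin d)) (M + 1)).isPreconnected
      _ _ (hcl fun t => v t = v t₀) (hcl fun t => v t ≠ v t₀)
      (fun y hy => by
        obtain ⟨s, hs⟩ := hcov y hy
        by_cases h' : v s = v t₀
        · exact Or.inl (mem_iUnion.mpr ⟨⟨s, h'⟩, hs⟩)
        · exact Or.inr (mem_iUnion.mpr ⟨⟨s, h'⟩, hs⟩))
      ⟨0, hball0, mem_iUnion.mpr ⟨⟨t₀, rfl⟩, ht₀⟩⟩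
      (by
        obtain ⟨z, hz, hzM⟩ := ht
        exact ⟨z, hzM, mem_iUnion.mpr ⟨⟨t, hne⟩, hz⟩⟩)
    obtain ⟨⟨t₁, h1⟩, hy1⟩ := mem_iUnion.mp hy1
    obtain ⟨⟨t₂, h2⟩, hy2⟩ := mem_iUnion.mp hy2
    simp only at hy1 hy2
    have hdist : ‖v t₂ - v t₁‖ ≤ 2 * δ := by linarith [norm_sub_le (v t₂) (v t₁), hvδ t₁, hvδ t₂]
    have htouch := hgap _ (hA t₁ y hy1 hyM) _ (hA t₂ y hy2 hyM) _ ((hmem t₁ y).mp hy1) _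
      ((hmem t₂ y).mp hy2) (by
        rw [dist_eq_norm, sub_sub_sub_cancel_left]
        linarith)
    have hF1 : (t₁.1.1, t₂.1.1, t₂.1.2 - t₁.1.2) ∈ {q : L × L × EuclideanSpace ℝ (Fin d) |
        ∃ T ∈ Ω, ∃ t ∈ T.tiles, ∃ t' ∈ T.tiles,
        (P.tileSupp t ∩ P.tileSupp t').Nonempty ∧ q = (t.1, t'.1, t'.2 - t.2)} :=
      ⟨T, hT, _, hS.1 t₁.2, _, hS.1 t₂.2, htouch, rfl⟩
    have hF2 : (t₁.1.1, t₂.1.1, t₂.1.2 - t₁.1.2 + (v t₂ - v t₁)) ∈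
        {q : L × L × EuclideanSpace ℝ (Fin d) |
        ∃ T ∈ Ω, ∃ t ∈ T.tiles, ∃ t' ∈ T.tiles,
        (P.tileSupp t ∩ P.tileSupp t').Nonempty ∧ q = (t.1, t'.1, t'.2 - t.2)} := by
      refine ⟨T', hT', _, hS'.1 (e t₁).2, _, hS'.1 (e t₂).2, ⟨y, hy1, hy2⟩, ?_⟩
      rw [hlab, hlab]
      refine Prod.ext rfl (Prod.ext rfl ?_)
      simp only [hv]
      abel
    have heq := hγF _ hF1 _ hF2 (by
      rw [Prod.dist_eq, Prod.dist_eq, dist_self, dist_self, dist_eq_norm, sub_add_cancel_left,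
        norm_neg]
      simp only [max_lt_iff]
      exact ⟨hγ, hγ, by linarith⟩)
    have h3 : v t₂ - v t₁ = 0 := by simpa using congrArg (fun q => q.2.2) heq
    exact h2 ((sub_eq_zero.mp h3).trans h1)
  refine ⟨-v t₀, by rw [norm_neg]; exact (hvδ t₀).trans_lt hδη, fun t ht => ?_⟩
  obtain ⟨y, hy, hyM⟩ := ht
  rw [mem_ball_zero_iff] at hyM
  rw [mem_translate]
  constructor
  · intro htT'
    have htS' : t ∈ S' := mem_of_mem_interior hS'.1 htT' hy
      (hc' (by rw [mem_closedBall_zero_iff]; linarith))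
    have h1 := hconst (e.symm ⟨t, htS'⟩) ⟨y, by
      rw [Equiv.apply_symm_apply]; exact interior_subset hy, by
      rw [mem_closedBall_zero_iff]; linarith⟩
    have h2 := hev (e.symm ⟨t, htS'⟩)
    rw [Equiv.apply_symm_apply, h1] at h2
    simp only at h2
    rw [h2, add_neg_cancel_right]
    exact hS.1 (e.symm ⟨t, htS'⟩).2
  · intro htT
    have hy' : y - v t₀ ∈ interior (P.tileSupp (t.1, t.2 + -v t₀)) := by
      rw [← P.mem_interior_tileSupp_add, neg_add_cancel_right]
      exact hy
    have hn := norm_sub_le y (v t₀)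
    have htS := mem_of_mem_interior hS.1 htT hy'
      (hc (by rw [mem_closedBall_zero_iff]; linarith [hvδ t₀]))
    have h1 := hconst ⟨_, htS⟩ ⟨y - v t₀ + v ⟨_, htS⟩, by
      rw [hmem, add_sub_cancel_right]; exact interior_subset hy', by
      rw [mem_closedBall_zero_iff]
      linarith [norm_add_le (y - v t₀) (v ⟨_, htS⟩), hvδ t₀, hvδ ⟨_, htS⟩]⟩
    have h2 := hev ⟨_, htS⟩
    rw [h1] at h2
    simp only [neg_add_cancel_right] at h2
    have h3 := hS'.1 (e ⟨_, htS⟩).2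
    rwa [h2] at h3

/-- Small translates of tilings that agree with `T` on a ball form a neighbourhood of `T`. -/
theorem IsFLC.exists_isOpen {Ω : Set (Tiling P)} (h : IsFLC Ω) (hΩ : IsClosed Ω) {T : Tiling P}
    {M η : ℝ} (hM : 0 < M) (hη : 0 < η) :
    ∃ U : Set (Tiling P), IsOpen U ∧ T ∈ U ∧ ∀ T' ∈ U, T' ∈ Ω →
      ∃ u, ‖u‖ < η ∧ T'.AgreesOn (T.translate u) (ball 0 M) := by
  refine ⟨Ωᶜ ∪ {T' | ∃ u, ‖u‖ < η ∧ ∃ M' > M, T'.AgreesOn (T.translate u) (ball 0 M')}, ?_, ?_, ?_⟩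
  · intro T₁ hT₁
    by_cases hΩ₁ : T₁ ∈ Ω
    · obtain ⟨u, hu, M', hM', hag⟩ := hT₁.resolve_left (not_not.mpr hΩ₁)
      obtain ⟨ε, hε, H⟩ := h.exists_forall_tilingDist_lt hΩ₁ (M := M') (hM.trans hM')
        (η := min (η - ‖u‖) ((M' - M) / 2))
        (lt_min (sub_pos.mpr hu) (half_pos (sub_pos.mpr hM')))
      refine ⟨ε, hε, fun T₂ hT₂ => ?_⟩
      by_cases hΩ₂ : T₂ ∈ Ω
      · obtain ⟨w, hw, hag'⟩ := H T₂ hΩ₂ hT₂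
        rw [lt_min_iff] at hw
        refine Or.inr ⟨u + w, (norm_add_le _ _).trans_lt (by linarith), (M + M') / 2, by linarith,
          ?_⟩
        rw [← translate_translate]
        refine (hag'.mono (ball_subset_ball (by linarith))).trans (hag.translate ?_)
        rw [zero_add, sub_zero]
        linarith
      · exact Or.inl hΩ₂
    · obtain ⟨ε, hε, H⟩ := hΩ.isOpen_compl T₁ hΩ₁
      exact ⟨ε, hε, fun T₂ hT₂ => Or.inl (H T₂ hT₂)⟩
  · refine Or.inr ⟨0, by simpa using hη, M + 1, by linarith, ?_⟩
    rw [translate_zero]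
    exact fun t _ => Iff.rfl
  · rintro T' (hT' | ⟨u, hu, M', hM', hag⟩) hT'Ω
    · exact absurd hT'Ω hT'
    · exact ⟨u, hu, hag.mono (ball_subset_ball hM'.le)⟩

/-- A continuous self-map of a tiling space of finite local complexity that is uniformly close to
the identity moves every tiling inside its translation orbit, by a small vector. For such a map `G`
the tiling `G (T - x)`, moved back by `x` and by the small vector `e x`, agrees with `T` near
`x`, while its restriction to any ball is locally constant, hence constant, in `x`. -/
theorem IsFLC.eq_translate_of_agreesOn {Ω : Set (Tiling P)} [T0Space Ω] (h : IsFLC Ω)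
    (hΩ : IsTilingSpace Ω) {r : ℝ} (hr0 : 0 < r) (hr1 : r ≤ 1)
    (hr : ∀ T ∈ Ω, ∀ t ∈ T.tiles, (interior (P.tileSupp t)).Nonempty →
      ∀ w, ‖w‖ < r → (t.1, t.2 + w) ∈ T.tiles → w = 0)
    {G : Ω → Ω} (hG : Continuous G) {ε : ℝ} (hε : ε ≤ r / 4)
    (hGε : ∀ T, ∃ e, ‖e‖ < ε ∧ (G T).1.AgreesOn (T.1.translate e) (ball 0 2)) (T : Ω) :
    ∃ e, ‖e‖ < ε ∧ (G T).1 = T.1.translate e := by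
  set τ : EuclideanSpace ℝ (Fin d) → Ω := fun x => ⟨T.1.translate x, hΩ.2 _ T.2 x⟩ with hτ
  have hτc : Continuous τ := T.1.continuous_translate.subtype_mk _
  choose e heε heG using fun x => hGε (τ x)
  set B : EuclideanSpace ℝ (Fin d) → Tiling P := fun x => (G (τ x)).1.translate (-(x + e x))
    with hB
  have hBΩ : ∀ x, B x ∈ Ω := fun x => hΩ.2 _ (G (τ x)).2 _
  have hBT : ∀ x, (B x).AgreesOn T.1 (ball x 1) := by
    intro x
    have h1 := (heG x).translate (x := -(x + e x)) (c := x) (s := 1) (by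
      rw [sub_zero, neg_add, add_neg_cancel_left, norm_neg]
      linarith [heε x])
    simp only [hτ, translate_translate] at h1
    rwa [add_neg_cancel, translate_zero] at h1
  have hloc : ∀ x₀ : EuclideanSpace ℝ (Fin d), ∀ M > 0, ∀ᶠ x in 𝓝 x₀,
      (B x).AgreesOn (B x₀) (ball 0 M) := by
    intro x₀ M hM
    obtain ⟨U, hU, hmU, hUag⟩ := h.exists_isOpen hΩ.1 (T := (G (τ x₀)).1)
      (M := M + 2 * ‖x₀‖ + 3) (η := r / 4) (by positivity) (by positivity)
    have hev : ∀ᶠ x in 𝓝 x₀, (G (τ x)).1 ∈ U :=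
      (continuous_subtype_val.comp (hG.comp hτc)).continuousAt.eventually_mem (hU.mem_nhds hmU)
    filter_upwards [hev, ball_mem_nhds x₀ (show 0 < r / 4 by positivity)] with x hxU hx
    rw [mem_ball, dist_eq_norm] at hx
    obtain ⟨u, hu, hag⟩ := hUag _ hxU (G (τ x)).2
    set w := e x₀ + x₀ + u - x - e x with hw
    have hwn : ‖w‖ < r := by
      have : w = e x₀ + u + -(x - x₀) + -(e x) := by rw [hw]; abel
      rw [this]
      have h1 := norm_add₄_le (a := e x₀) (b := u) (c := -(x - x₀)) (d := -(e x))
      rw [norm_neg, norm_neg] at h1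
      linarith [heε x₀, heε x]
    have htr : ∀ (c : EuclideanSpace ℝ (Fin d)) (s : ℝ), ‖c‖ + s ≤ M + ‖x₀‖ + 1 →
        (B x).AgreesOn ((B x₀).translate w) (ball c s) := by
      intro c s hcs
      have h1 := hag.translate (x := -(x + e x)) (c := c) (s := s) (by
        have h2 : c + -(x + e x) - 0 = c + -x₀ + -(x - x₀) + -(e x) := by abel
        rw [h2]
        have h3 := norm_add₄_le (a := c) (b := -x₀) (c := -(x - x₀)) (d := -(e x))
        rw [norm_neg, norm_neg, norm_neg] at h3
        linarith [heε x])
      have h4 : ((G (τ x₀)).1.translate u).translate (-(x + e x)) = (B x₀).translate w := by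
        simp only [hB, translate_translate]
        congr 1
        rw [hw]
        abel
      rwa [h4] at h1
    -- A fat tile of `T` near `x₀` occurs in `B x₀` and, moved by `w`, too.
    have hw0 : w = 0 := by
      obtain ⟨t, ht, z, hzt, hz⟩ := T.1.exists_mem_interior_inter_ball x₀
        (show (0 : ℝ) < 1 / 2 by norm_num)
      have hz1 : z ∈ ball x 1 := by
        rw [mem_ball] at hz ⊢
        have := dist_triangle z x₀ x
        rw [dist_comm x₀, dist_eq_norm x] at this
        linarith
      have hz0 : z ∈ ball x₀ 1 := ball_subset_ball (by norm_num) hz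
      have ht1 : t ∈ (B x).tiles := (hBT x t ⟨z, hzt, hz1⟩).mpr ht
      have ht0 : t ∈ (B x₀).tiles := (hBT x₀ t ⟨z, hzt, hz0⟩).mpr ht
      have ht2 := (htr x₀ 1 (by linarith) t ⟨z, hzt, hz0⟩).mp ht1
      exact hr _ (hBΩ x₀) t ht0 ⟨z, hzt⟩ w hwn (mem_translate.mp ht2)
    have h5 := htr 0 M (by rw [norm_zero]; linarith [norm_nonneg x₀])
    rwa [hw0, translate_zero] at h5
  have hconst : ∀ t, (interior (P.tileSupp t)).Nonempty → ∀ x,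
      (t ∈ (B x).tiles ↔ t ∈ (B 0).tiles) := by
    rintro t ⟨y, hy⟩ x
    have hlc : IsLocallyConstant fun x => (t ∈ (B x).tiles : Prop) := by
      refine (IsLocallyConstant.iff_eventually_eq _).mpr fun x₀ => ?_
      filter_upwards [hloc x₀ (‖y‖ + 1) (by positivity)] with x hx
      exact propext (hx t ⟨y, hy, by rw [mem_ball_zero_iff]; linarith⟩)
    exact iff_of_eq (hlc.apply_eq_of_preconnectedSpace x 0)
  have hfat : ∀ t, (interior (P.tileSupp t)).Nonempty → (t ∈ (B 0).tiles ↔ t ∈ T.1.tiles) := by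
    rintro t ⟨y, hy⟩
    exact (hconst t ⟨y, hy⟩ y).symm.trans (hBT y t ⟨y, hy, mem_ball_self one_pos⟩)
  have hins : Inseparable (⟨B 0, hBΩ 0⟩ : Ω) T :=
    Topology.IsInducing.subtypeVal.inseparable_iff.mp (inseparable_of_fat hfat)
  have hBT0 : B 0 = T.1 := congrArg Subtype.val hins.eq
  have hτ0 : τ 0 = T := Subtype.ext (translate_zero _)
  refine ⟨e 0, heε 0, ?_⟩
  rw [← hBT0]
  simp only [hB, translate_translate, hτ0]
  rw [zero_add, neg_add_cancel, translate_zero]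

end Tiling

end FLC

/-! ### The dyadic solenoid -/

theorem dyadicBond_coe (k : ℕ) (r : ℝ) :
    dyadicBond k (r : AddCircle ((2 : ℝ) ^ (k + 1))) = (r : AddCircle ((2 : ℝ) ^ k)) :=
  rfl

theorem continuous_dyadicBond (k : ℕ) : Continuous (dyadicBond k) :=
  (QuotientAddGroup.isQuotientMap_mk _).continuous_iff.mpr
    (AddCircle.continuous_mk' ((2 : ℝ) ^ k))

instance DyadicSolenoid.instCompactSpace : CompactSpace DyadicSolenoid := by
  have : ∀ k : ℕ, Fact ((0 : ℝ) < 2 ^ k) := fun k => ⟨by positivity⟩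
  refine isCompact_iff_compactSpace.mp (IsClosed.isCompact ?_)
  have h : {x : ∀ k : ℕ, AddCircle ((2 : ℝ) ^ k) | ∀ k, dyadicBond k (x (k + 1)) = x k} =
      ⋂ k, {x | dyadicBond k (x (k + 1)) = x k} := by
    ext x
    simp
  change IsClosed {x : ∀ k : ℕ, AddCircle ((2 : ℝ) ^ k) | ∀ k, dyadicBond k (x (k + 1)) = x k}
  rw [h]
  exact isClosed_iInter fun k => isClosed_eq
    ((continuous_dyadicBond k).comp (continuous_apply _)) (continuous_apply _)

/-- A real number representing one coordinate difference represents the previous ones as well. -/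
theorem DyadicSolenoid.sub_eq_coe_of_le (x y : DyadicSolenoid) {r : ℝ} {j k : ℕ} (hjk : j ≤ k)
    (h : x.1 k - y.1 k = (r : AddCircle ((2 : ℝ) ^ k))) :
    x.1 j - y.1 j = (r : AddCircle ((2 : ℝ) ^ j)) := by
  induction k, hjk using Nat.le_induction with
  | base => exact h
  | succ k _ ih =>
    refine ih ?_
    rw [← x.2 k, ← y.2 k, ← map_sub, h, dyadicBond_coe]

/-- The flow on the solenoid along its path components. -/
noncomputable def DyadicSolenoid.flow (t : ℝ) (x : DyadicSolenoid) : DyadicSolenoid :=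
  ⟨fun k => x.1 k + (t : AddCircle ((2 : ℝ) ^ k)), fun k => by
    rw [map_add, x.2 k, dyadicBond_coe]⟩

theorem DyadicSolenoid.continuous_flow (t : ℝ) : Continuous (DyadicSolenoid.flow t) :=
  Continuous.subtype_mk (continuous_pi fun k =>
    ((continuous_apply k).comp continuous_subtype_val).add continuous_const) _

theorem coe_two_pow_eq_zero {k n : ℕ} (h : k ≤ n) :
    (((2 : ℝ) ^ n : ℝ) : AddCircle ((2 : ℝ) ^ k)) = 0 := by
  refine (AddCircle.coe_eq_zero_iff _).mpr ⟨2 ^ (n - k), ?_⟩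
  rw [zsmul_eq_mul]
  push_cast
  rw [← pow_add, Nat.sub_add_cancel h]

/-- The maps `flow (2 ^ n)` converge uniformly to the identity. -/
theorem DyadicSolenoid.exists_flow_mem {V : Set (DyadicSolenoid × DyadicSolenoid)}
    (hV : V ∈ uniformity DyadicSolenoid) : ∃ n : ℕ, ∀ x, (x, flow (2 ^ n) x) ∈ V := by
  have h : Filter.Tendsto (fun q : ℕ × DyadicSolenoid => (q.2, flow (2 ^ q.1) q.2))
      (Filter.atTop ×ˢ ⊤) (uniformity DyadicSolenoid) := by
    rw [uniformity_subtype, Filter.tendsto_comap_iff, Pi.uniformity, Filter.tendsto_iInf]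
    intro k
    rw [Filter.tendsto_comap_iff]
    intro W hW
    rw [Filter.mem_map]
    filter_upwards [(Filter.eventually_ge_atTop k).prod_inl (⊤ : Filter DyadicSolenoid)] with q hq
    have : (flow (2 ^ q.1) q.2).1 k = q.2.1 k := by
      simp only [flow, coe_two_pow_eq_zero hq, add_zero]
    simp only [mem_preimage, Function.comp_apply, this]
    exact refl_mem_uniformity hW
  obtain ⟨pa, hpa, pb, hpb, H⟩ := Filter.eventually_prod_iff.mp (h.eventually_mem hV)
  obtain ⟨n, hn⟩ := hpa.exists
  rw [Filter.eventually_top] at hpb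
  exact ⟨n, fun x => H hn (hpb x)⟩

theorem norm_coe_pow_zero_eq_half {k : ℕ} {a : ℝ}
    (h : ‖(a : AddCircle ((2 : ℝ) ^ k))‖ = 1 / 2) :
    1 / 4 ≤ ‖(a : AddCircle ((2 : ℝ) ^ 0))‖ := by
  rw [AddCircle.norm_eq] at h ⊢
  by_contra! hlt
  set m : ℤ := round (((2 : ℝ) ^ k)⁻¹ * a) * 2 ^ k with hm
  set l : ℤ := round (((2 : ℝ) ^ 0)⁻¹ * a) with hl
  rw [pow_zero, mul_one] at hlt
  have hm' : (m : ℝ) = round (((2 : ℝ) ^ k)⁻¹ * a) * 2 ^ k := by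
    rw [hm]
    push_cast
    ring
  rw [← hm'] at h
  have h1 : 0 < |(m : ℝ) - l| := by
    have := abs_sub_abs_le_abs_sub (a - (m : ℝ)) (a - l)
    rw [sub_sub_sub_cancel_left, abs_sub_comm (l : ℝ)] at this
    linarith
  have h2 : |(m : ℝ) - l| < 1 := by
    have := abs_sub (a - (l : ℝ)) (a - m)
    rw [sub_sub_sub_cancel_left] at this
    linarith
  rw [← Int.cast_sub, ← Int.cast_abs] at h1 h2
  have h3 : 0 < |m - l| := by exact_mod_cast h1
  have h4 : |m - l| < 1 := by exact_mod_cast h2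
  omega

/-- A path joining `x` to `flow (2 ^ n) x` cannot stay where the first coordinate is close to that
of `x`: within such a set the Cantor set coordinate transverse to the flow is constant along paths,
but `x` and `flow (2 ^ n) x` differ in it. -/
theorem DyadicSolenoid.exists_le_norm_sub {n : ℕ} {x : DyadicSolenoid} {f : ℝ → DyadicSolenoid}
    (hf : Continuous f) (h0 : f 0 = x) (h1 : f 1 = flow (2 ^ n) x) :
    ∃ t ∈ Icc (0 : ℝ) 1, 1 / 4 ≤ ‖(f t).1 0 - x.1 0‖ := by
  have hc : Continuous fun t => ‖(f t).1 (n + 1) - x.1 (n + 1)‖ :=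
    (((continuous_apply _).comp (continuous_subtype_val.comp hf)).sub continuous_const).norm
  have h1' : ‖(f 1).1 (n + 1) - x.1 (n + 1)‖ = 2 ^ n := by
    have h2 : (2 : ℝ) ^ n = 2 ^ (n + 1) / 2 := by ring
    have h3 : |(2 : ℝ) ^ (n + 1)| = 2 ^ (n + 1) := abs_of_pos (by positivity)
    simp only [h1, flow, add_sub_cancel_left]
    rw [h2, AddCircle.norm_half_period_eq, h3]
  have hhalf : (1 / 2 : ℝ) ∈ Icc ‖(f 0).1 (n + 1) - x.1 (n + 1)‖
      ‖(f 1).1 (n + 1) - x.1 (n + 1)‖ := by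
    rw [h1', h0, sub_self, norm_zero]
    exact ⟨by norm_num, by linarith [one_le_pow₀ (M₀ := ℝ) (one_le_two) (n := n)]⟩
  obtain ⟨t, ht, hteq⟩ := intermediate_value_Icc zero_le_one hc.continuousOn hhalf
  refine ⟨t, ht, ?_⟩
  obtain ⟨a, ha⟩ := QuotientAddGroup.mk_surjective ((f t).1 (n + 1) - x.1 (n + 1))
  rw [(f t).sub_eq_coe_of_le x (Nat.zero_le _) ha.symm]
  simp only at hteq
  rw [← ha] at hteq
  exact norm_coe_pow_zero_eq_half hteq

/-- No tiling space of finite local complexity is homeomorphic to the dyadic solenoid. -/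
theorem Tiling.IsFLC.isEmpty_homeomorph {d : ℕ} {L : Type*} [MetricSpace L] [CompactSpace L]
    {P : PrototileSet d L} {Ω : Set (Tiling P)} (hΩ : IsTilingSpace Ω) (h : IsFLC Ω) :
    IsEmpty (DyadicSolenoid ≃ₜ Ω) := by
  refine ⟨fun φ => ?_⟩
  have : T0Space Ω := φ.t0Space
  obtain ⟨r', hr', hsep⟩ := h.exists_separation
  set r := min r' 1 with hr
  have hr0 : 0 < r := lt_min hr' one_pos
  set x : DyadicSolenoid := ⟨fun k => 0, fun k => map_zero _⟩ with hx
  set T : Ω := φ x with hT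
  set τ : EuclideanSpace ℝ (Fin d) → Ω := fun y => ⟨T.1.translate y, hΩ.2 _ T.2 y⟩ with hτ
  have hτc : Continuous τ := T.1.continuous_translate.subtype_mk _
  have hτ0 : τ 0 = T := Subtype.ext (translate_zero _)
  have hcoord : Continuous fun y => ‖(φ.symm (τ y)).1 0 - x.1 0‖ :=
    (((continuous_apply 0).comp (continuous_subtype_val.comp
      (φ.symm.continuous.comp hτc))).sub continuous_const).norm
  obtain ⟨ε₁, hε₁, hcoordε⟩ : ∃ ε₁ > 0, ∀ y, ‖y‖ < ε₁ →
      ‖(φ.symm (τ y)).1 0 - x.1 0‖ < 1 / 4 := by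
    have h0 : ‖(φ.symm (τ 0)).1 0 - x.1 0‖ < 1 / 4 := by
      rw [hτ0, hT, φ.symm_apply_apply, sub_self, norm_zero]
      norm_num
    obtain ⟨ε₁, hε₁, H⟩ := Metric.mem_nhds_iff.mp
      (hcoord.continuousAt.eventually_lt continuousAt_const h0)
    exact ⟨ε₁, hε₁, fun y hy => H (mem_ball_zero_iff.mpr hy)⟩
  set ε := min (r / 4) ε₁ with hε
  have hε0 : 0 < ε := lt_min (by positivity) hε₁
  have hεr : ε ≤ r / 4 := min_le_left _ _
  -- For large `n`, the map `flow (2 ^ n)` is close to the identity of the tiling space.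
  choose U hU hmU hUag using fun y : DyadicSolenoid =>
    h.exists_isOpen hΩ.1 (T := (φ y).1) (M := 3) (η := ε / 2) (by norm_num) (half_pos hε0)
  obtain ⟨V, hV, hVU⟩ := lebesgue_number_lemma (isCompact_univ (X := DyadicSolenoid))
    (U := fun y => (fun z => (φ z).1) ⁻¹' U y)
    (fun y => (hU y).preimage (continuous_subtype_val.comp φ.continuous))
    (fun y _ => mem_iUnion.mpr ⟨y, hmU y⟩)
  obtain ⟨n, hn⟩ := DyadicSolenoid.exists_flow_mem hV
  have hG : ∀ S : Ω, ∃ e, ‖e‖ < ε ∧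
      (φ (DyadicSolenoid.flow (2 ^ n) (φ.symm S))).1.AgreesOn (S.1.translate e) (ball 0 2) := by
    intro S
    obtain ⟨i, hi⟩ := hVU (φ.symm S) (mem_univ _)
    obtain ⟨u, hu, hag⟩ := hUag i _ (hi (refl_mem_uniformity hV)) (φ (φ.symm S)).2
    obtain ⟨u', hu', hag'⟩ := hUag i _ (hi (hn (φ.symm S))) (φ _).2
    simp only [φ.apply_symm_apply] at hag
    have hle : ‖u' - u‖ < ε := (norm_sub_le _ _).trans_lt (by linarith)
    refine ⟨u' - u, hle, ?_⟩
    have h1 := hag.translate (x := u' - u) (c := 0) (s := 2) (by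
      rw [zero_add, sub_zero]
      linarith [min_le_right r' 1])
    rw [translate_translate, add_sub_cancel] at h1
    exact (hag'.mono (ball_subset_ball (by norm_num))).trans h1.symm
  obtain ⟨e, he, heq⟩ := h.eq_translate_of_agreesOn hΩ hr0 (min_le_right _ _)
    (fun S hS t ht hfat w hw => hsep S hS t ht hfat w (hw.trans_le (min_le_left _ _)))
    (φ.continuous.comp ((DyadicSolenoid.continuous_flow _).comp φ.symm.continuous)) hεr hG T
  obtain ⟨t, ht, hle⟩ := DyadicSolenoid.exists_le_norm_sub (n := n) (x := x)
    (f := fun t => φ.symm (τ (t • e)))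
    (φ.symm.continuous.comp (hτc.comp (by fun_prop)))
    (by simp only [zero_smul, hτ0, hT, φ.symm_apply_apply])
    (by
      simp only [one_smul]
      rw [φ.symm_apply_eq]
      refine Subtype.ext ?_
      rw [Function.comp_apply, Function.comp_apply, hT, φ.symm_apply_apply] at heq
      exact heq.symm)
  refine absurd (hcoordε (t • e) ?_) (not_lt.mpr hle)
  rw [norm_smul, Real.norm_of_nonneg ht.1]
  have h2 : t * ‖e‖ ≤ ‖e‖ := mul_le_of_le_one_left (norm_nonneg _) ht.2
  exact h2.trans_lt (he.trans_le (min_le_right _ _))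

/-! ### Interval tiles -/

theorem hausdorffDist_Icc_le {a b a' b' δ : ℝ} (hab : a ≤ b) (hab' : a' ≤ b')
    (ha : |a - a'| ≤ δ) (hb : |b - b'| ≤ δ) : hausdorffDist (Icc a b) (Icc a' b') ≤ δ := by
  have key : ∀ a b a' b' : ℝ, a' ≤ b' → |a - a'| ≤ δ → |b - b'| ≤ δ → ∀ x ∈ Icc a b,
      ∃ y ∈ Icc a' b', dist x y ≤ δ := by
    intro a b a' b' hab' ha hb x hx
    rw [abs_le] at ha hb
    rcases le_total x a' with h | h
    · refine ⟨a', left_mem_Icc.mpr hab', ?_⟩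
      rw [Real.dist_eq, abs_le]
      constructor <;> linarith [hx.1, hx.2]
    rcases le_total x b' with h' | h'
    · exact ⟨x, ⟨h, h'⟩, by rw [dist_self]; linarith⟩
    · refine ⟨b', right_mem_Icc.mpr hab', ?_⟩
      rw [Real.dist_eq, abs_le]
      constructor <;> linarith [hx.1, hx.2]
  refine hausdorffDist_le_of_mem_dist ((abs_nonneg _).trans ha) (key a b a' b' hab' ha hb) ?_
  rw [abs_sub_comm] at ha hb
  exact key a' b' a b hab ha hb

theorem abs_sub_le_of_hausdorffDist_Icc_le {a b a' b' δ : ℝ} (hab : a ≤ b) (hab' : a' ≤ b')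
    (h : hausdorffDist (Icc a b) (Icc a' b') ≤ δ) : |a - a'| ≤ δ ∧ |b - b'| ≤ δ := by
  have key : ∀ a b a' b' : ℝ, a ≤ b → a' ≤ b' → hausdorffDist (Icc a b) (Icc a' b') ≤ δ →
      a' - a ≤ δ ∧ b - b' ≤ δ := by
    intro a b a' b' hab hab' h
    have hfin := hausdorffEDist_ne_top_of_nonempty_of_bounded (nonempty_Icc.mpr hab)
      (nonempty_Icc.mpr hab') (isBounded_Icc a b) (isBounded_Icc a' b')
    constructor
    · refine le_of_forall_gt fun r hr => ?_
      obtain ⟨y, hy, hyr⟩ := exists_dist_lt_of_hausdorffDist_lt (left_mem_Icc.mpr hab)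
        (h.trans_lt hr) hfin
      rw [Real.dist_eq, abs_lt] at hyr
      linarith [hy.1]
    · refine le_of_forall_gt fun r hr => ?_
      obtain ⟨y, hy, hyr⟩ := exists_dist_lt_of_hausdorffDist_lt (right_mem_Icc.mpr hab)
        (h.trans_lt hr) hfin
      rw [Real.dist_eq, abs_lt] at hyr
      linarith [hy.2]
  have h1 := key a b a' b' hab hab' h
  have h2 := key a' b' a b hab' hab (by rwa [hausdorffDist_comm])
  constructor <;> rw [abs_le] <;> constructor <;> linarith [h1.1, h1.2, h2.1, h2.2]

/-- The identification of the one-dimensional Euclidean space with the real line. -/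
noncomputable def lineHomeo : EuclideanSpace ℝ (Fin 1) ≃ₜ ℝ :=
  (EuclideanSpace.equiv (Fin 1) ℝ).toHomeomorph.trans (Homeomorph.funUnique (Fin 1) ℝ)

theorem lineHomeo_apply (y : EuclideanSpace ℝ (Fin 1)) : lineHomeo y = y 0 :=
  rfl

theorem single_apply_zero (y : EuclideanSpace ℝ (Fin 1)) :
    EuclideanSpace.single (0 : Fin 1) (y 0) = y := by
  ext i
  rw [Subsingleton.elim i 0]
  simp

theorem norm_eq_abs_apply_zero (y : EuclideanSpace ℝ (Fin 1)) : ‖y‖ = |y 0| := by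
  conv_lhs => rw [← single_apply_zero y]
  simp

section Stretched

variable {len : C(ℤ_[2], ℝ)} {hlen : ∀ q, 0 < len q}

theorem mem_interval {s : ℝ} {hs : 0 < s} {y : EuclideanSpace ℝ (Fin 1)} :
    y ∈ interval s hs ↔ y 0 ∈ Icc 0 s := by
  constructor
  · rintro ⟨r, hr, rfl⟩
    simpa using hr
  · exact fun h => ⟨y 0, h, single_apply_zero y⟩

theorem stretched_tileSupp (t : StretchedLabel len × EuclideanSpace ℝ (Fin 1)) :
    (stretchedPrototiles len hlen).tileSupp t =
      lineHomeo ⁻¹' Icc (t.2 0) (t.2 0 + t.1.1.2) := by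
  ext y
  change y - t.2 ∈ interval t.1.1.2 (stretchedLabel_pos len hlen t.1) ↔ _
  rw [mem_interval]
  simp only [PiLp.sub_apply, mem_Icc, mem_preimage, lineHomeo_apply]
  constructor <;> rintro ⟨h1, h2⟩ <;> constructor <;> linarith

theorem interior_stretched_tileSupp (t : StretchedLabel len × EuclideanSpace ℝ (Fin 1)) :
    interior ((stretchedPrototiles len hlen).tileSupp t) =
      lineHomeo ⁻¹' Ioo (t.2 0) (t.2 0 + t.1.1.2) := by
  rw [stretched_tileSupp, ← Homeomorph.preimage_interior, interior_Icc]

theorem frontier_stretched_tileSupp (hlen : ∀ q, 0 < len q)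
    (t : StretchedLabel len × EuclideanSpace ℝ (Fin 1)) :
    frontier ((stretchedPrototiles len hlen).tileSupp t) =
      lineHomeo ⁻¹' {t.2 0, t.2 0 + t.1.1.2} := by
  rw [stretched_tileSupp, ← Homeomorph.preimage_frontier, frontier_Icc]
  linarith [stretchedLabel_pos len hlen t.1]

theorem hausdorffDist_stretched_tileSupp
    (t t' : StretchedLabel len × EuclideanSpace ℝ (Fin 1)) :
    hausdorffDist ((stretchedPrototiles len hlen).tileSupp t)
      ((stretchedPrototiles len hlen).tileSupp t') =
    hausdorffDist (Icc (t.2 0) (t.2 0 + t.1.1.2)) (Icc (t'.2 0) (t'.2 0 + t'.1.1.2)) := by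
  have h : ∀ t : StretchedLabel len × EuclideanSpace ℝ (Fin 1),
      (stretchedPrototiles len hlen).tileSupp t =
      (fun r : ℝ => EuclideanSpace.single (0 : Fin 1) r) '' Icc (t.2 0) (t.2 0 + t.1.1.2) := by
    intro t
    rw [stretched_tileSupp]
    ext y
    constructor
    · exact fun hy => ⟨y 0, hy, single_apply_zero y⟩
    · rintro ⟨r, hr, rfl⟩
      simpa [lineHomeo_apply] using hr
  rw [h, h, hausdorffDist_image isometry_single_fin_one]

/-! ### Placements of the odometer tiles -/

/-- The `i`-th tile of the stretched solenoid tiling given by `p` and the end points `e`. -/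
noncomputable def stretchedTile (len : C(ℤ_[2], ℝ)) (p : ℤ_[2]) (e : ℤ → ℝ) (i : ℤ) :
    StretchedLabel len × EuclideanSpace ℝ (Fin 1) :=
  (stretchedLabel len (p + i), EuclideanSpace.single (0 : Fin 1) (e i))

theorem stretchedTile_shift (len : C(ℤ_[2], ℝ)) (p : ℤ_[2]) (e : ℤ → ℝ) (m i : ℤ) :
    stretchedTile len (p + m) (fun i => e (m + i)) i = stretchedTile len p e (m + i) := by
  simp only [stretchedTile, Int.cast_add, add_assoc]

theorem range_stretchedTile_shift (len : C(ℤ_[2], ℝ)) (p : ℤ_[2]) (e : ℤ → ℝ) (m : ℤ) :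
    range (stretchedTile len (p + m) fun i => e (m + i)) = range (stretchedTile len p e) := by
  rw [funext (stretchedTile_shift len p e m)]
  exact (Equiv.addLeft m).surjective.range_comp (stretchedTile len p e)

theorem tiles_translate_eq_range {T : Tiling (stretchedPrototiles len hlen)} {p : ℤ_[2]}
    {e : ℤ → ℝ} (hT : T.tiles = range (stretchedTile len p e)) (x : EuclideanSpace ℝ (Fin 1)) :
    (T.translate x).tiles = range (stretchedTile len p fun i => e i - x 0) := by
  change (fun t => (t.1, t.2 - x)) '' T.tiles = _
  rw [hT, ← range_comp]
  congr 1
  funext i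
  refine Prod.ext rfl ?_
  ext k
  rw [Subsingleton.elim k 0]
  simp [stretchedTile]

/-- The numbers `e i` are the left end points of consecutive intervals of lengths `len (p + i)`. -/
def IsPlacement (len : C(ℤ_[2], ℝ)) (p : ℤ_[2]) (e : ℤ → ℝ) : Prop :=
  ∀ i, e (i + 1) = e i + len (p + i)

namespace IsPlacement

variable {p : ℤ_[2]} {e : ℤ → ℝ}

theorem sub_const (he : IsPlacement len p e) (x : ℝ) : IsPlacement len p fun i => e i - x :=
  fun i => by linarith [he i]

theorem shift (he : IsPlacement len p e) (m : ℤ) :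
    IsPlacement len (p + m) fun i => e (m + i) := fun i => by
  have := he (m + i)
  rw [Int.cast_add, ← add_assoc] at this
  simp only [← add_assoc, this]

theorem unique {e' : ℤ → ℝ} (he : IsPlacement len p e) (he' : IsPlacement len p e')
    (h0 : e 0 = e' 0) (i : ℤ) : e i = e' i := by
  induction i using Int.induction_on with
  | zero => exact h0
  | succ i ih => rw [he, he', ih]
  | pred i ih =>
    have h1 := he (-i - 1)
    have h2 := he' (-i - 1)
    rw [sub_add_cancel] at h1 h2
    linarith

theorem add_sub_le (he : IsPlacement len p e) (h1 : ∀ q, 1 ≤ len q) {i j : ℤ} (hij : i ≤ j) :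
    e i + (j - i : ℝ) ≤ e j := by
  induction j, hij using Int.leInduction with
  | base => simp
  | succ j _ ih =>
    rw [he j]
    push_cast
    linarith [h1 (p + j)]

theorem strictMono (he : IsPlacement len p e) (h1 : ∀ q, 1 ≤ len q) : StrictMono e := by
  intro i j hij
  have := he.add_sub_le h1 hij.le
  have h2 : (i : ℝ) < j := by exact_mod_cast hij
  linarith

theorem exists_index (he : IsPlacement len p e) (h1 : ∀ q, 1 ≤ len q) (y : ℝ) :
    ∃ i, e i ≤ y ∧ y < e (i + 1) := by
  obtain ⟨i, hi, hmax⟩ := Int.exists_greatest_of_bdd (P := fun i => e i ≤ y)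
    ⟨max 0 ⌈y - e 0⌉, fun i hi => by
      rcases le_total i 0 with h | h
      · exact le_max_of_le_left h
      · refine le_max_of_le_right ?_
        have h2 := he.add_sub_le h1 h
        have h3 : (i : ℝ) ≤ ⌈y - e 0⌉ := by
          refine le_trans ?_ (Int.le_ceil _)
          simp only [Int.cast_zero, sub_zero] at h2
          linarith
        exact_mod_cast h3⟩
    ⟨min 0 ⌊y - e 0⌋, by
      have h2 := he.add_sub_le h1 (min_le_left 0 ⌊y - e 0⌋)
      have h3 : ((min 0 ⌊y - e 0⌋ : ℤ) : ℝ) ≤ y - e 0 := by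
        refine le_trans ?_ (Int.floor_le _)
        exact_mod_cast min_le_right _ _
      simp only [Int.cast_zero] at h2
      linarith⟩
  refine ⟨i, hi, ?_⟩
  by_contra! h
  have := hmax _ h
  omega

theorem mem_tileSupp_iff (he : IsPlacement len p e) {i : ℤ} {y : EuclideanSpace ℝ (Fin 1)} :
    y ∈ (stretchedPrototiles len hlen).tileSupp (stretchedTile len p e i) ↔
      e i ≤ y 0 ∧ y 0 ≤ e (i + 1) := by
  rw [stretched_tileSupp, he i]
  simp [stretchedTile, lineHomeo_apply, stretchedLabel]

theorem mem_interior_tileSupp_iff (he : IsPlacement len p e) {i : ℤ}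
    {y : EuclideanSpace ℝ (Fin 1)} :
    y ∈ interior ((stretchedPrototiles len hlen).tileSupp (stretchedTile len p e i)) ↔
      e i < y 0 ∧ y 0 < e (i + 1) := by
  rw [interior_stretched_tileSupp, he i]
  simp [stretchedTile, lineHomeo_apply, stretchedLabel]

theorem mem_frontier_tileSupp_iff (he : IsPlacement len p e) {i : ℤ}
    {y : EuclideanSpace ℝ (Fin 1)} :
    y ∈ frontier ((stretchedPrototiles len hlen).tileSupp (stretchedTile len p e i)) ↔
      y 0 = e i ∨ y 0 = e (i + 1) := by
  rw [frontier_stretched_tileSupp, he i]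
  simp [stretchedTile, lineHomeo_apply, stretchedLabel]

theorem hausdorffDist_tileSupp (he : IsPlacement len p e) {p' : ℤ_[2]} {e' : ℤ → ℝ}
    (he' : IsPlacement len p' e') (i j : ℤ) :
    hausdorffDist ((stretchedPrototiles len hlen).tileSupp (stretchedTile len p e i))
      ((stretchedPrototiles len hlen).tileSupp (stretchedTile len p' e' j)) =
    hausdorffDist (Icc (e i) (e (i + 1))) (Icc (e' j) (e' (j + 1))) := by
  rw [hausdorffDist_stretched_tileSupp, he i, he' j]
  simp [stretchedTile, stretchedLabel]

theorem stretchedTile_injective (he : IsPlacement len p e) (h1 : ∀ q, 1 ≤ len q) :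
    Function.Injective (stretchedTile len p e) := by
  intro i j hij
  refine (he.strictMono h1).injective ?_
  have := congrArg (fun t => t.2 0) hij
  simpa [stretchedTile] using this

/-- The union of the tiles with indices in `Ico a b` is an interval. -/
theorem biUnion_tileSupp (he : IsPlacement len p e) (h1 : ∀ q, 1 ≤ len q) {a b : ℤ}
    (hab : a < b) :
    ⋃ t ∈ stretchedTile len p e '' Ico a b, (stretchedPrototiles len hlen).tileSupp t =
      lineHomeo ⁻¹' Icc (e a) (e b) := by
  have hm := (he.strictMono h1)
  ext y
  rw [biUnion_image]
  simp only [mem_iUnion, he.mem_tileSupp_iff, mem_preimage, lineHomeo_apply]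
  constructor
  · rintro ⟨i, hi, h2, h3⟩
    exact ⟨(hm.monotone hi.1).trans h2, h3.trans (hm.monotone (Int.add_one_le_of_lt hi.2))⟩
  · rintro ⟨h2, h3⟩
    obtain ⟨i, hi, hi'⟩ := he.exists_index h1 (y 0)
    have hai : a < i + 1 := hm.lt_iff_lt.mp (h2.trans_lt hi')
    have hib : i ≤ b := hm.le_iff_le.mp (hi.trans h3)
    rcases hib.lt_or_eq with h | rfl
    · exact ⟨i, ⟨by omega, h⟩, hi, hi'.le⟩
    · refine ⟨i - 1, ⟨by omega, by omega⟩, (hm.monotone (by omega)).trans hi, ?_⟩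
      rwa [sub_add_cancel]

/-- The tiling given by a placement. -/
noncomputable def tiling (he : IsPlacement len p e) (hlen : ∀ q, 0 < len q)
    (h1 : ∀ q, 1 ≤ len q) : Tiling (stretchedPrototiles len hlen) where
  tiles := range (stretchedTile len p e)
  cover y := by
    obtain ⟨i, hi, hi'⟩ := he.exists_index h1 (y 0)
    exact ⟨_, ⟨i, rfl⟩, he.mem_tileSupp_iff.mpr ⟨hi, hi'.le⟩⟩
  inter_subset := by
    have key : ∀ i j : ℤ, i < j → ∀ y : EuclideanSpace ℝ (Fin 1), y 0 ≤ e (i + 1) → e j ≤ y 0 →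
        y 0 = e (i + 1) ∧ y 0 = e j := by
      intro i j hij y h2 h3
      have := (he.strictMono h1).monotone (Int.add_one_le_of_lt hij)
      exact ⟨le_antisymm h2 (this.trans h3), le_antisymm (h2.trans this) h3⟩
    rintro _ ⟨i, rfl⟩ _ ⟨j, rfl⟩ hne y ⟨hi, hj⟩
    rw [he.mem_tileSupp_iff] at hi hj
    rw [mem_inter_iff, he.mem_frontier_tileSupp_iff, he.mem_frontier_tileSupp_iff]
    have hij : i ≠ j := fun h => hne (by rw [h])
    rcases hij.lt_or_gt with h | h
    · have := key i j h y hi.2 hj.1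
      exact ⟨Or.inr this.1, Or.inl this.2⟩
    · have := key j i h y hj.2 hi.1
      exact ⟨Or.inl this.2, Or.inr this.1⟩
  locally_finite r := by
    obtain ⟨a, ha, -⟩ := he.exists_index h1 (-r)
    obtain ⟨b, -, hb⟩ := he.exists_index h1 r
    refine ((finite_Icc (a - 1) (b + 1)).image (stretchedTile len p e)).subset ?_
    rintro _ ⟨⟨i, rfl⟩, y, hy, hyr⟩
    rw [he.mem_tileSupp_iff] at hy
    rw [mem_closedBall_zero_iff, norm_eq_abs_apply_zero, abs_le] at hyr
    have hm := he.strictMono h1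
    have h2 : a ≤ i + 1 := hm.le_iff_le.mp (ha.trans (hyr.1.trans hy.2))
    have h3 : i < b + 1 := hm.lt_iff_lt.mp ((hy.1.trans hyr.2).trans_lt hb)
    exact ⟨i, ⟨by omega, by omega⟩, rfl⟩

theorem isPatch_image_Ico (he : IsPlacement len p e) (h1 : ∀ q, 1 ≤ len q) {a b : ℤ}
    (hab : a < b) :
    (he.tiling hlen h1).IsPatch (stretchedTile len p e '' Ico a b) := by
  refine ⟨image_subset_range _ _, (finite_Ico a b).image _, ?_⟩
  rw [he.biUnion_tileSupp h1 hab]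
  exact (Homeomorph.isConnected_preimage _).mpr
    (isConnected_Icc ((he.strictMono h1).monotone hab.le))

end IsPlacement

/-- The left end point of the `i`-th tile of the odometer tiling given by `p`, when the tile with
index `0` starts at the origin. -/
noncomputable def odometerSum (len : C(ℤ_[2], ℝ)) (p : ℤ_[2]) (i : ℤ) : ℝ :=
  ∑ j ∈ Finset.Ico 0 i, len (p + (j : ℤ)) - ∑ j ∈ Finset.Ico i 0, len (p + (j : ℤ))

theorem odometerSum_zero (len : C(ℤ_[2], ℝ)) (p : ℤ_[2]) : odometerSum len p 0 = 0 := by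
  simp [odometerSum]

theorem continuous_odometerSum (len : C(ℤ_[2], ℝ)) (i : ℤ) :
    Continuous fun p => odometerSum len p i := by
  unfold odometerSum
  fun_prop

theorem isPlacement_odometerSum (len : C(ℤ_[2], ℝ)) (p : ℤ_[2]) :
    IsPlacement len p (odometerSum len p) := by
  intro i
  unfold odometerSum
  rcases le_or_gt 0 i with h | h
  · rw [Finset.Ico_eq_empty_of_le h, Finset.Ico_eq_empty_of_le (by omega : (0 : ℤ) ≤ i + 1)]
    have : Finset.Ico 0 (i + 1) = insert i (Finset.Ico 0 i) := by
      ext j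
      simp only [Finset.mem_Ico, Finset.mem_insert]
      omega
    rw [this, Finset.sum_insert (by simp)]
    simp only [Finset.sum_empty]
    ring
  · rw [Finset.Ico_eq_empty_of_le h.le, Finset.Ico_eq_empty_of_le (by omega : i + 1 ≤ 0)]
    have : Finset.Ico i 0 = insert i (Finset.Ico (i + 1) 0) := by
      ext j
      simp only [Finset.mem_Ico, Finset.mem_insert]
      omega
    rw [this, Finset.sum_insert (by simp)]
    simp only [Finset.sum_empty]
    ring

theorem odometerSum_add (len : C(ℤ_[2], ℝ)) (p : ℤ_[2]) (m i : ℤ) :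
    odometerSum len p (m + i) = odometerSum len p m + odometerSum len (p + m) i := by
  have h1 := ((isPlacement_odometerSum len p).shift m).sub_const (odometerSum len p m)
  have h2 := h1.unique (isPlacement_odometerSum len (p + m)) (by
    simp [odometerSum_zero]) i
  linarith

/-! ### The topology of the stretched solenoid -/

theorem isPlacement_odometerSum_sub (len : C(ℤ_[2], ℝ)) (q : ℤ_[2] × ℝ) :
    IsPlacement len q.1 fun i => odometerSum len q.1 i - q.2 :=
  (isPlacement_odometerSum len q.1).sub_const q.2

/-- The odometer tiling in which the tile at the point `q.1` of the odometer has its left end point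
at `-q.2`. -/
noncomputable def odometerTiling (len : C(ℤ_[2], ℝ)) (hlen : ∀ q, 0 < len q)
    (h1 : ∀ q, 1 ≤ len q) (q : ℤ_[2] × ℝ) : Tiling (stretchedPrototiles len hlen) :=
  (isPlacement_odometerSum_sub len q).tiling hlen h1

theorem IsPlacement.tiling_eq {p : ℤ_[2]} {e : ℤ → ℝ} (he : IsPlacement len p e)
    (h1 : ∀ q, 1 ≤ len q) : he.tiling hlen h1 = odometerTiling len hlen h1 (p, -e 0) := by
  have : e = fun i => odometerSum len p i - -e 0 := by
    funext i
    exact he.unique (isPlacement_odometerSum_sub len (p, -e 0)) (by simp [odometerSum_zero]) i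
  refine Tiling.ext ?_
  change range (stretchedTile len p e) = range (stretchedTile len p _)
  rw [← this]

theorem stretchedSolenoid_eq_range (h1 : ∀ q, 1 ≤ len q) :
    stretchedSolenoid len hlen = range (odometerTiling len hlen h1) := by
  ext T
  constructor
  · rintro ⟨p, e, he, hT⟩
    refine ⟨(p, -e 0), ?_⟩
    rw [← IsPlacement.tiling_eq he h1]
    exact Tiling.ext hT.symm
  · rintro ⟨q, rfl⟩
    exact ⟨q.1, fun i => odometerSum len q.1 i - q.2, isPlacement_odometerSum_sub len q, rfl⟩

theorem odometerTiling_add (h1 : ∀ q, 1 ≤ len q) (q : ℤ_[2] × ℝ) (m : ℤ) :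
    odometerTiling len hlen h1 (q.1 + m, q.2 - odometerSum len q.1 m) =
      odometerTiling len hlen h1 q := by
  refine Tiling.ext ?_
  have hfun : (fun i => odometerSum len (q.1 + m) i - (q.2 - odometerSum len q.1 m)) =
      fun i => (fun i => odometerSum len q.1 i - q.2) (m + i) := by
    funext i
    simp only [odometerSum_add]
    ring
  change range (stretchedTile len (q.1 + m) fun i =>
    odometerSum len (q.1 + m) i - (q.2 - odometerSum len q.1 m)) = _
  rw [hfun]
  exact range_stretchedTile_shift len q.1 (fun i => odometerSum len q.1 i - q.2) m

theorem Int.eq_add_of_forall_succ {j : ℤ → ℤ} (h : ∀ i, j (i + 1) = j i + 1) (i : ℤ) :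
    j i = j 0 + i := by
  induction i using Int.induction_on with
  | zero => simp
  | succ i ih =>
    rw [h]
    omega
  | pred i ih =>
    have := h (-i - 1)
    rw [sub_add_cancel] at this
    omega

/-- The norms of the points of an orbit of the odometer determine its starting point. -/
theorem PadicInt.eq_of_forall_norm_add_int_eq {p p' : ℤ_[2]}
    (h : ∀ i : ℤ, ‖p + (i : ℤ_[2])‖ = ‖p' + (i : ℤ_[2])‖) : p = p' := by
  have h2 := PadicInt.denseRange_intCast.induction_on
    (p := fun s : ℤ_[2] => ‖p + s‖ = ‖p' + s‖) (-p)
    (isClosed_eq (by fun_prop) (by fun_prop)) h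
  simp only [add_neg_cancel, norm_zero] at h2
  have h3 := norm_eq_zero.mp h2.symm
  rw [← sub_eq_add_neg] at h3
  exact (sub_eq_zero.mp h3).symm

theorem odometerTiling_eq_iff (h1 : ∀ q, 1 ≤ len q) {q q' : ℤ_[2] × ℝ} :
    odometerTiling len hlen h1 q = odometerTiling len hlen h1 q' ↔
      ∃ m : ℤ, q = (q'.1 + m, q'.2 - odometerSum len q'.1 m) := by
  constructor
  · intro h
    have he := isPlacement_odometerSum_sub len q
    have he' := isPlacement_odometerSum_sub len q'
    have htile : ∀ i, ∃ j, stretchedTile len q'.1 (fun i => odometerSum len q'.1 i - q'.2) j =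
        stretchedTile len q.1 (fun i => odometerSum len q.1 i - q.2) i := by
      intro i
      have : stretchedTile len q.1 (fun i => odometerSum len q.1 i - q.2) i ∈
          (odometerTiling len hlen h1 q').tiles := by
        rw [← h]
        exact ⟨i, rfl⟩
      exact this
    choose j hj using htile
    have hpos : ∀ i, odometerSum len q'.1 (j i) - q'.2 = odometerSum len q.1 i - q.2 := fun i => by
      simpa [stretchedTile] using congrArg (fun t => t.2 0) (hj i)
    have hlab : ∀ i, (‖q'.1 + (j i : ℤ)‖, len (q'.1 + (j i : ℤ))) =
        (‖q.1 + (i : ℤ)‖, len (q.1 + (i : ℤ))) :=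
      fun i => congrArg (fun t => t.1.1) (hj i)
    have hsucc : ∀ i, j (i + 1) = j i + 1 := by
      intro i
      refine (he'.strictMono h1).injective ?_
      have h2 := he i
      have h3 := he' (j i)
      have h4 := congrArg Prod.snd (hlab i)
      simp only [hpos] at h2 h3 h4 ⊢
      rw [h2, h3, h4]
    have hadd := Int.eq_add_of_forall_succ hsucc
    refine ⟨j 0, Prod.ext ?_ ?_⟩
    · refine PadicInt.eq_of_forall_norm_add_int_eq fun i => ?_
      have := congrArg Prod.fst (hlab i)
      rw [hadd i, Int.cast_add, ← add_assoc] at this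
      exact this.symm
    · have := hpos 0
      rw [odometerSum_zero] at this
      simp only
      linarith
  · rintro ⟨m, rfl⟩
    exact odometerTiling_add h1 q' m

theorem continuous_stretchedLabel (len : C(ℤ_[2], ℝ)) : Continuous (stretchedLabel len) :=
  Continuous.subtype_mk (by fun_prop) _

theorem continuous_odometerTiling (h1 : ∀ q, 1 ≤ len q) :
    Continuous (odometerTiling len hlen h1) := by
  refine Tiling.continuous_of_tilingDist fun q ε hε => ?_
  set δ := min (ε / 2) 1 with hδ
  have hδ0 : 0 < δ := by positivity
  obtain ⟨n, hn⟩ := exists_nat_ge (1 / δ + |q.2| + 1)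
  have hn0 : 0 < (n : ℝ) := by
    have : 0 < 1 / δ := by positivity
    linarith [abs_nonneg q.2]
  have hnn : (-n : ℤ) < n := by
    have : 0 < n := by exact_mod_cast hn0
    omega
  have hpos : ∀ᶠ q' in 𝓝 q, ∀ i ∈ Icc (-n : ℤ) n,
      |(odometerSum len q.1 i - q.2) - (odometerSum len q'.1 i - q'.2)| ≤ δ := by
    refine (Filter.eventually_all_finite (finite_Icc _ _)).mpr fun i _ => ?_
    have hc : Continuous fun q' : ℤ_[2] × ℝ =>
        |(odometerSum len q.1 i - q.2) - (odometerSum len q'.1 i - q'.2)| :=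
      (continuous_const.sub (((continuous_odometerSum len i).comp continuous_fst).sub
        continuous_snd)).abs
    exact (hc.continuousAt.eventually_lt continuousAt_const (by simpa using hδ0)).mono
      fun _ h => h.le
  have hlab : ∀ᶠ q' in 𝓝 q, ∀ i ∈ Ico (-n : ℤ) n,
      dist (stretchedLabel len (q.1 + (i : ℤ))) (stretchedLabel len (q'.1 + (i : ℤ))) ≤ δ := by
    refine (Filter.eventually_all_finite (finite_Ico _ _)).mpr fun i _ => ?_
    have hc : Continuous fun q' : ℤ_[2] × ℝ =>
        dist (stretchedLabel len (q.1 + (i : ℤ))) (stretchedLabel len (q'.1 + (i : ℤ))) :=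
      continuous_const.dist ((continuous_stretchedLabel len).comp (by fun_prop))
    exact (hc.continuousAt.eventually_lt continuousAt_const (by simpa using hδ0)).mono
      fun _ h => h.le
  filter_upwards [hpos, hlab, (continuous_snd.tendsto q).eventually (ball_mem_nhds q.2 one_pos)]
    with q' hq'pos hq'lab hq'2
  rw [Real.dist_eq] at hq'2
  refine (Tiling.tilingDist_le hδ0 (min_le_right _ _) ?_).trans_lt
    ((min_le_left _ _).trans_lt (half_lt_self hε))
  have he := isPlacement_odometerSum_sub len q
  have he' := isPlacement_odometerSum_sub len q'
  have hcov : ∀ q' : ℤ_[2] × ℝ, |q'.2 - q.2| < 1 → closedBall 0 (1 / δ) ⊆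
      ⋃ t ∈ stretchedTile len q'.1 (fun i => odometerSum len q'.1 i - q'.2) '' Ico (-n : ℤ) n,
        (stretchedPrototiles len hlen).tileSupp t := by
    intro q' hq' y hy
    rw [(isPlacement_odometerSum_sub len q').biUnion_tileSupp h1 hnn]
    rw [mem_closedBall_zero_iff, norm_eq_abs_apply_zero, abs_le] at hy
    have h2 := (isPlacement_odometerSum len q'.1).add_sub_le h1 (by omega : (-n : ℤ) ≤ 0)
    have h3 := (isPlacement_odometerSum len q'.1).add_sub_le h1 (by omega : (0 : ℤ) ≤ n)
    rw [odometerSum_zero] at h2 h3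
    push_cast at h2 h3
    have h4 := abs_lt.mp hq'
    have h5 := abs_le.mp (le_refl |q.2|)
    simp only [mem_preimage, lineHomeo_apply, mem_Icc]
    constructor <;> linarith
  refine Tiling.agreeUpTo_of_injOn (I := Ico (-n : ℤ) n)
    (he.stretchedTile_injective h1).injOn (he'.stretchedTile_injective h1).injOn
    (he.isPatch_image_Ico h1 hnn) (he'.isPatch_image_Ico h1 hnn) (hcov q (by simp)) (hcov q' hq'2)
    fun i hi => ⟨?_, hq'lab i hi⟩
  rw [he.hausdorffDist_tileSupp he']
  exact hausdorffDist_Icc_le ((he.strictMono h1).monotone (by omega))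
    ((he'.strictMono h1).monotone (by omega)) (hq'pos i ⟨hi.1, hi.2.le⟩)
    (hq'pos (i + 1) ⟨by have := hi.1; omega, Int.add_one_le_of_lt hi.2⟩)

/-- A tiling that contains all the tiles of an odometer tiling has no others. -/
theorem eq_odometerTiling_of_forall_mem (h1 : ∀ q, 1 ≤ len q)
    {T : Tiling (stretchedPrototiles len hlen)} {q : ℤ_[2] × ℝ}
    (h : ∀ i, stretchedTile len q.1 (fun i => odometerSum len q.1 i - q.2) i ∈ T.tiles) :
    T = odometerTiling len hlen h1 q := by
  have hsub : (odometerTiling len hlen h1 q).tiles ⊆ T.tiles := by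
    rintro _ ⟨i, rfl⟩
    exact h i
  refine Tiling.ext (Subset.antisymm (fun t ht => ?_) hsub)
  have hpos := stretchedLabel_pos len hlen t.1
  set y : EuclideanSpace ℝ (Fin 1) := EuclideanSpace.single 0 (t.2 0 + t.1.1.2 / 2) with hy
  have hyt : y ∈ interior ((stretchedPrototiles len hlen).tileSupp t) := by
    rw [interior_stretched_tileSupp]
    simp only [hy, mem_preimage, lineHomeo_apply, PiLp.single_apply, if_true, mem_Ioo]
    constructor <;> linarith
  obtain ⟨s, hs, hys⟩ := (odometerTiling len hlen h1 q).cover y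
  exact Tiling.mem_of_mem_interior hsub ht hyt (mem_iUnion₂.mpr ⟨s, hs, hys⟩)

/-- Compact sets of parameters give closed sets of tilings: if `T` is approximated by odometer
tilings whose parameters converge, then the tiles of the limiting odometer tiling are limits of
tiles of `T` from a bounded region, hence tiles of `T`. -/
theorem isClosed_image_odometerTiling (h1 : ∀ q, 1 ≤ len q) {A : Set (ℤ_[2] × ℝ)}
    (hA : IsCompact A) : IsClosed (odometerTiling len hlen h1 '' A) := by
  refine isOpen_compl_iff.mp fun T hT => ?_
  by_contra! hno
  have hseq : ∀ n : ℕ, ∃ q ∈ A,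
      T.tilingDist (odometerTiling len hlen h1 q) < 1 / ((n : ℝ) + 1) := by
    intro n
    obtain ⟨T', hT', hmem⟩ := hno (1 / ((n : ℝ) + 1)) (by positivity)
    obtain ⟨q, hq, rfl⟩ := not_not.mp hmem
    exact ⟨q, hq, hT'⟩
  choose a haA haT using hseq
  obtain ⟨q, hqA, φ, hφ, hlim⟩ := hA.tendsto_subseq haA
  refine hT ⟨q, hqA, (eq_odometerTiling_of_forall_mem h1 fun i => ?_).symm⟩
  have he := fun q => isPlacement_odometerSum_sub len q
  set f : ℤ_[2] × ℝ → StretchedLabel len × EuclideanSpace ℝ (Fin 1) :=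
    fun q => stretchedTile len q.1 (fun i => odometerSum len q.1 i - q.2) i with hf
  have hfc : Continuous f := by
    refine Continuous.prodMk ((continuous_stretchedLabel len).comp (by fun_prop)) ?_
    exact isometry_single_fin_one.continuous.comp
      (((continuous_odometerSum len i).comp continuous_fst).sub continuous_snd)
  have hflim : Filter.Tendsto (fun n => f (a (φ n))) Filter.atTop (𝓝 (f q)) :=
    (hfc.tendsto q).comp hlim
  set R := ‖(f q).2‖ + 2 with hR
  have hbound : ∀ᶠ n in Filter.atTop, ‖(f (a (φ n))).2‖ < R - 1 := by
    have := ((continuous_snd.tendsto _).comp hflim).norm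
    exact this.eventually (gt_mem_nhds (by rw [hR]; linarith))
  have hbig : ∀ᶠ n : ℕ in Filter.atTop, R ≤ (φ n : ℝ) + 1 := by
    obtain ⟨N, hN⟩ := exists_nat_ge R
    filter_upwards [Filter.eventually_ge_atTop N] with n hn
    have h2 : (n : ℝ) ≤ φ n := by exact_mod_cast hφ.id_le n
    have h3 : (N : ℝ) ≤ n := by exact_mod_cast hn
    linarith
  have hex : ∀ n, ‖(f (a (φ n))).2‖ < R - 1 → R ≤ (φ n : ℝ) + 1 →
      ∃ t ∈ {t ∈ T.tiles | ((stretchedPrototiles len hlen).tileSupp t ∩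
        closedBall 0 R).Nonempty}, dist t (f (a (φ n))) ≤ 1 / ((φ n : ℝ) + 1) := by
    intro n hn hRn
    have hR1 : (1 : ℝ) ≤ (φ n : ℝ) + 1 := by linarith [Nat.cast_nonneg (α := ℝ) (φ n)]
    obtain ⟨δ, hδ0, hδ, hag⟩ := Tiling.exists_agreeUpTo_of_tilingDist_lt
      (div_le_one_of_le₀ hR1 (by positivity)) (haT (φ n))
    have hδ1 : δ ≤ 1 := hδ.le.trans (div_le_one_of_le₀ hR1 (by positivity))
    have hRδ : R ≤ 1 / δ := by
      rw [lt_div_iff₀ (by positivity)] at hδ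
      rw [le_div_iff₀ hδ0]
      nlinarith
    have hfn : ‖(f (a (φ n))).2‖ = |odometerSum len (a (φ n)).1 i - (a (φ n)).2| := by
      simp [hf, stretchedTile]
    have hsucc := he (a (φ n)) i
    have hlen1 := h1 ((a (φ n)).1 + (i : ℤ))
    obtain ⟨t, ht, hd1, hd2⟩ := hag.symm.exists_corresponding (t := f (a (φ n))) ⟨i, rfl⟩
      (y := EuclideanSpace.single 0 (odometerSum len (a (φ n)).1 i - (a (φ n)).2 + 1 / 2))
      ((he _).mem_interior_tileSupp_iff.mpr (by
        simp only at hsucc ⊢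
        rw [hsucc]
        simp only [PiLp.single_apply, if_true]
        constructor <;> linarith))
      (by
        rw [norm_eq_abs_apply_zero]
        simp only [PiLp.single_apply, if_true]
        have h4 := abs_add_le (odometerSum len (a (φ n)).1 i - (a (φ n)).2) (1 / 2)
        rw [abs_of_pos (by norm_num : (0 : ℝ) < 1 / 2)] at h4
        linarith)
    rw [hausdorffDist_stretched_tileSupp] at hd1
    have hd3 := (abs_sub_le_of_hausdorffDist_Icc_le
      (by linarith [stretchedLabel_pos len hlen (f (a (φ n))).1])
      (by linarith [stretchedLabel_pos len hlen t.1]) hd1).1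
    have hd4 : dist t.2 (f (a (φ n))).2 ≤ δ := by
      rw [dist_comm, dist_eq_norm, norm_eq_abs_apply_zero]
      exact hd3
    refine ⟨t, ⟨ht, t.2, PrototileSet.controlPoint_mem _ t, ?_⟩, ?_⟩
    · rw [mem_closedBall_zero_iff]
      rw [dist_eq_norm] at hd4
      have := norm_le_norm_add_norm_sub' t.2 (f (a (φ n))).2
      linarith
    · rw [Prod.dist_eq, dist_comm t.1]
      exact max_le (hd2.trans hδ.le) (hd4.trans hδ.le)
  have hcl : IsClosed {t ∈ T.tiles | ((stretchedPrototiles len hlen).tileSupp t ∩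
      closedBall 0 R).Nonempty} := (T.locally_finite R).isClosed
  refine (hcl.closure_eq ▸ Metric.mem_closure_iff.mpr fun ε hε => ?_ :
    f q ∈ {t ∈ T.tiles | ((stretchedPrototiles len hlen).tileSupp t ∩
      closedBall 0 R).Nonempty}).1
  have hsmall : ∀ᶠ n in Filter.atTop, 1 / ((φ n : ℝ) + 1) < ε / 2 :=
    ((tendsto_one_div_add_atTop_nhds_zero_nat (𝕜 := ℝ)).comp hφ.tendsto_atTop).eventually
      (gt_mem_nhds (half_pos hε))
  have hclose : ∀ᶠ n in Filter.atTop, dist (f (a (φ n))) (f q) < ε / 2 :=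
    hflim.eventually (ball_mem_nhds _ (half_pos hε))
  obtain ⟨n, ⟨⟨hn1, hn2⟩, hn3⟩, hn4⟩ :=
    (((hbound.and hbig).and hsmall).and hclose).exists
  obtain ⟨t, ht, htd⟩ := hex n hn1 hn2
  refine ⟨t, ht, ?_⟩
  rw [dist_comm]
  linarith [dist_triangle t (f (a (φ n))) (f q)]

end Stretched

/-! ### The length function -/

namespace PadicInt

theorem norm_two : ‖(2 : ℤ_[2])‖ = 1 / 2 := by
  have := PadicInt.norm_p (p := 2)
  simpa using this

theorem norm_two_mul_add_one (r : ℤ_[2]) : ‖2 * r + 1‖ = 1 := by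
  refine le_antisymm (PadicInt.norm_le_one _) (not_lt.mp fun h => ?_)
  have h1 := PadicInt.norm_lt_one_iff_dvd _ |>.mp h
  rw [Nat.cast_ofNat] at h1
  obtain ⟨s, hs⟩ := (dvd_add_right (dvd_mul_right 2 r)).mp h1
  have h2 := congrArg norm hs
  rw [norm_one, norm_mul, norm_two] at h2
  linarith [PadicInt.norm_le_one s]

theorem exists_eq_two_mul_or (q : ℤ_[2]) : ∃ r, q = 2 * r ∨ q = 2 * r + 1 := by
  obtain ⟨n, hn, hq⟩ := PadicInt.exists_mem_range q
  rw [PadicInt.maximalIdeal_eq_span_p, Ideal.mem_span_singleton, Nat.cast_ofNat] at hq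
  obtain ⟨r, hr⟩ := hq
  refine ⟨r, ?_⟩
  interval_cases n
  · left
    simpa using hr
  · right
    rw [← hr]
    simp

/-- The shift on binary expansions: `half (2 * r) = half (2 * r + 1) = r`. -/
noncomputable def half (q : ℤ_[2]) : ℤ_[2] :=
  (exists_eq_two_mul_or q).choose

/-- The last binary digit of a `2`-adic integer, as a real number. -/
noncomputable def lastDigit (q : ℤ_[2]) : ℝ :=
  open Classical in if q = 2 * half q then 0 else 1

theorem half_two_mul_and_lastDigit (r : ℤ_[2]) :
    half (2 * r) = r ∧ lastDigit (2 * r) = 0 := by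
  have h : half (2 * r) = r := by
    rcases (exists_eq_two_mul_or (2 * r)).choose_spec with h | h
    · exact (mul_left_cancel₀ two_ne_zero h).symm
    · have h1 := norm_two_mul_add_one ((exists_eq_two_mul_or (2 * r)).choose)
      rw [← h, norm_mul, norm_two] at h1
      linarith [PadicInt.norm_le_one r]
  exact ⟨h, by rw [lastDigit, h, if_pos rfl]⟩

theorem half_two_mul_add_one_and_lastDigit (r : ℤ_[2]) :
    half (2 * r + 1) = r ∧ lastDigit (2 * r + 1) = 1 := by
  have hne : ∀ s, 2 * r + 1 ≠ 2 * s := fun s h => by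
    have h1 := norm_two_mul_add_one r
    rw [h, norm_mul, norm_two] at h1
    linarith [PadicInt.norm_le_one s]
  have h : half (2 * r + 1) = r := by
    rcases (exists_eq_two_mul_or (2 * r + 1)).choose_spec with h | h
    · exact absurd h (hne _)
    · exact (mul_left_cancel₀ two_ne_zero (add_right_cancel h)).symm
  exact ⟨h, by rw [lastDigit, if_neg (hne _)]⟩

theorem dist_half_le_and_dist_lastDigit_le (q q' : ℤ_[2]) :
    dist (half q) (half q') ≤ 2 * dist q q' ∧ dist (lastDigit q) (lastDigit q') ≤ dist q q' := by
  have key : ∀ r s : ℤ_[2], dist (2 * r) (2 * s + 1) = 1 := fun r s => by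
    rw [dist_comm, dist_eq_norm, ← norm_two_mul_add_one (s - r)]
    congr 1
    ring
  have hone : ∀ r s : ℤ_[2], dist r s ≤ 1 := fun r s => by
    rw [dist_eq_norm]
    exact PadicInt.norm_le_one _
  have hsame : ∀ r s : ℤ_[2], dist r s = 2 * dist (2 * r) (2 * s) := fun r s => by
    rw [dist_eq_norm, dist_eq_norm, ← mul_sub, norm_mul, norm_two]
    ring
  obtain ⟨r, rfl | rfl⟩ := exists_eq_two_mul_or q <;>
    obtain ⟨s, rfl | rfl⟩ := exists_eq_two_mul_or q' <;>
    simp only [half_two_mul_and_lastDigit, half_two_mul_add_one_and_lastDigit]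
  · rw [dist_self]
    exact ⟨(hsame r s).le, dist_nonneg⟩
  · rw [key, Real.dist_eq]
    exact ⟨(hone r s).trans (by norm_num), by norm_num⟩
  · rw [dist_comm (2 * r + 1), key, Real.dist_eq]
    exact ⟨(hone r s).trans (by norm_num), by norm_num⟩
  · rw [dist_self, dist_add_right]
    exact ⟨(hsame r s).le, dist_nonneg⟩

theorem continuous_half : Continuous half :=
  (LipschitzWith.of_dist_le_mul (K := 2) fun q q' =>
    (dist_half_le_and_dist_lastDigit_le q q').1).continuous

theorem continuous_lastDigit : Continuous lastDigit :=
  (LipschitzWith.of_dist_le_mul (K := 1) fun q q' => by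
    rw [NNReal.coe_one, one_mul]
    exact (dist_half_le_and_dist_lastDigit_le q q').2).continuous

theorem lastDigit_mem (q : ℤ_[2]) : 0 ≤ lastDigit q ∧ lastDigit q ≤ 1 := by
  unfold lastDigit
  split_ifs <;> norm_num

/-- The binary expansion of a `2`-adic integer, read backwards as a real number in `[0, 2]`. -/
noncomputable def reversal (q : ℤ_[2]) : ℝ :=
  ∑' k : ℕ, lastDigit (half^[k] q) * (1 / 2) ^ k

theorem summable_reversal (q : ℤ_[2]) :
    Summable fun k : ℕ => lastDigit (half^[k] q) * (1 / 2 : ℝ) ^ k :=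
  Summable.of_nonneg_of_le (fun _ => mul_nonneg (lastDigit_mem _).1 (by positivity))
    (fun _ => mul_le_of_le_one_left (by positivity) (lastDigit_mem _).2) summable_geometric_two

theorem continuous_reversal : Continuous reversal :=
  continuous_tsum (fun k => (continuous_lastDigit.comp (continuous_half.iterate k)).mul_const _)
    summable_geometric_two fun k q => by
      rw [Real.norm_of_nonneg (mul_nonneg (lastDigit_mem _).1 (by positivity))]
      exact mul_le_of_le_one_left (by positivity) (lastDigit_mem _).2

theorem reversal_nonneg (q : ℤ_[2]) : 0 ≤ reversal q :=
  tsum_nonneg fun _ => mul_nonneg (lastDigit_mem _).1 (by positivity)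

theorem reversal_le_two (q : ℤ_[2]) : reversal q ≤ 2 := by
  rw [← tsum_geometric_two]
  exact (summable_reversal q).tsum_le_tsum
    (fun _ => mul_le_of_le_one_left (by positivity) (lastDigit_mem _).2) summable_geometric_two

theorem reversal_eq (q : ℤ_[2]) : reversal q = lastDigit q + reversal (half q) / 2 := by
  unfold reversal
  rw [(summable_reversal q).tsum_eq_zero_add, ← tsum_div_const, Function.iterate_zero, id_eq,
    pow_zero, mul_one]
  congr 1
  refine tsum_congr fun k => ?_
  rw [Function.iterate_succ_apply, pow_succ]
  ring

theorem reversal_two_mul (r : ℤ_[2]) : reversal (2 * r) = reversal r / 2 := by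
  rw [reversal_eq, (half_two_mul_and_lastDigit r).1, (half_two_mul_and_lastDigit r).2, zero_add]

theorem reversal_two_mul_add_one (r : ℤ_[2]) :
    reversal (2 * r + 1) = 1 + reversal r / 2 := by
  rw [reversal_eq, (half_two_mul_add_one_and_lastDigit r).1,
    (half_two_mul_add_one_and_lastDigit r).2]

/-- The sums of `reversal` over aligned blocks of length `2 ^ n` reproduce the function `reversal`,
at the scale `2 ^ n` but without any loss in size. -/
theorem exists_sum_reversal_eq (n : ℕ) : ∃ C : ℝ, ∀ r : ℤ_[2],
    ∑ j ∈ Finset.range (2 ^ n), reversal (2 ^ n * r + j) = C + reversal r := by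
  have hpair : ∀ (f : ℕ → ℝ) (N : ℕ), ∑ j ∈ Finset.range (2 * N), f j =
      ∑ i ∈ Finset.range N, (f (2 * i) + f (2 * i + 1)) := by
    intro f N
    induction N with
    | zero => simp
    | succ N ih =>
      rw [mul_add, mul_one, Finset.sum_range_succ, Finset.sum_range_succ, ih,
        Finset.sum_range_succ, add_assoc]
  induction n with
  | zero => exact ⟨0, fun r => by simp⟩
  | succ n ih =>
    obtain ⟨C, hC⟩ := ih
    refine ⟨2 ^ n + C, fun r => ?_⟩
    rw [pow_succ', hpair, add_assoc, ← hC r]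
    have hterm : ∀ i : ℕ, reversal (2 ^ (n + 1) * r + ((2 * i : ℕ) : ℤ_[2])) +
        reversal (2 ^ (n + 1) * r + ((2 * i + 1 : ℕ) : ℤ_[2])) =
        1 + reversal (2 ^ n * r + i) := by
      intro i
      have h1 : 2 ^ (n + 1) * r + ((2 * i : ℕ) : ℤ_[2]) = 2 * (2 ^ n * r + i) := by
        push_cast
        ring
      have h2 : 2 ^ (n + 1) * r + ((2 * i + 1 : ℕ) : ℤ_[2]) = 2 * (2 ^ n * r + i) + 1 := by
        push_cast
        ring
      rw [h1, h2, reversal_two_mul, reversal_two_mul_add_one]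
      ring
    simp only [hterm]
    rw [Finset.sum_add_distrib]
    simp

theorem exists_eq_two_pow_mul (q : ℤ_[2]) (n : ℕ) :
    ∃ (i : ℤ) (s : ℤ_[2]), q + i = 2 ^ n * s := by
  have h := PadicInt.appr_spec n q
  rw [Ideal.mem_span_singleton] at h
  obtain ⟨s, hs⟩ := h
  exact ⟨-(q.appr n : ℤ), s, by push_cast; rw [← sub_eq_add_neg, hs]; simp⟩

end PadicInt

/-- The length function of the stretched solenoid. -/
noncomputable def stretch : C(ℤ_[2], ℝ) :=
  ⟨fun q => 1 + PadicInt.reversal q, continuous_const.add PadicInt.continuous_reversal⟩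

theorem stretch_apply (q : ℤ_[2]) : stretch q = 1 + PadicInt.reversal q :=
  rfl

theorem one_le_stretch (q : ℤ_[2]) : 1 ≤ stretch q := by
  rw [stretch_apply]
  linarith [PadicInt.reversal_nonneg q]

theorem stretch_pos (q : ℤ_[2]) : 0 < stretch q :=
  one_pos.trans_le (one_le_stretch q)

/-! ### Expansiveness -/

theorem IsPlacement.add_nat {len : C(ℤ_[2], ℝ)} {p : ℤ_[2]} {e : ℤ → ℝ}
    (he : IsPlacement len p e) (i : ℤ) (n : ℕ) :
    e (i + n) = e i + ∑ j ∈ Finset.range n, len (p + i + j) := by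
  induction n with
  | zero => simp
  | succ n ih =>
    rw [Finset.sum_range_succ, ← add_assoc (e i), ← ih, Nat.cast_succ, ← add_assoc, he]
    push_cast
    rw [← add_assoc]

/-- Tilings given by different points of the odometer drift apart: with `p' - p = 2 ^ n * u`, `u`
odd, the lengths of the blocks of `2 ^ n` tiles that start where `p + i` is a multiple of
`2 ^ (n + 2)` differ by at least `1 / 2`. -/
theorem exists_le_abs_sub_of_ne {p p' : ℤ_[2]} {e e' : ℤ → ℝ} (he : IsPlacement stretch p e)
    (he' : IsPlacement stretch p' e') (hne : p ≠ p') : ∃ i, 1 / 4 ≤ |e i - e' i| := by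
  by_contra! hlt
  have hz : p' - p ≠ 0 := sub_ne_zero.mpr hne.symm
  set n := (p' - p).valuation with hn
  have hspec := PadicInt.unitCoeff_spec hz
  rw [← hn, Nat.cast_ofNat] at hspec
  obtain ⟨w, hw⟩ : ∃ w, (PadicInt.unitCoeff hz : ℤ_[2]) = 2 * w + 1 := by
    obtain ⟨w, hw | hw⟩ := PadicInt.exists_eq_two_mul_or (PadicInt.unitCoeff hz : ℤ_[2])
    · have h1 := PadicInt.norm_units (PadicInt.unitCoeff hz)
      rw [hw, norm_mul, PadicInt.norm_two] at h1
      linarith [PadicInt.norm_le_one w]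
    · exact ⟨w, hw⟩
  obtain ⟨i, s, hs⟩ := PadicInt.exists_eq_two_pow_mul p (n + 2)
  obtain ⟨C, hC⟩ := PadicInt.exists_sum_reversal_eq n
  have hblock : ∀ r : ℤ_[2], ∑ j ∈ Finset.range (2 ^ n), stretch (2 ^ n * r + j) =
      2 ^ n + C + PadicInt.reversal r := by
    intro r
    simp only [stretch_apply]
    rw [Finset.sum_add_distrib, hC]
    simp [add_assoc]
  have hp : p + i = 2 ^ n * (2 * (2 * s)) := by
    rw [hs]
    ring
  have hp' : p' + i = 2 ^ n * (2 * (2 * s + w) + 1) := by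
    have : p' + i = (p' - p) + (p + i) := by ring
    rw [this, hspec, hw, hp]
    ring
  have h1 := he.add_nat i (2 ^ n)
  have h2 := he'.add_nat i (2 ^ n)
  rw [hp, hblock, PadicInt.reversal_two_mul, PadicInt.reversal_two_mul] at h1
  rw [hp', hblock, PadicInt.reversal_two_mul_add_one] at h2
  have h3 := abs_lt.mp (hlt i)
  have h4 := abs_lt.mp (hlt (i + (2 ^ n : ℕ)))
  linarith [PadicInt.reversal_le_two s, PadicInt.reversal_nonneg (2 * s + w)]

theorem isExpansive_stretchedSolenoid :
    Tiling.IsExpansive (stretchedSolenoid stretch stretch_pos) := by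
  refine ⟨1 / 4, by norm_num, ?_⟩
  rintro T ⟨p, e, he, hT⟩ T' ⟨p', e', he', hT'⟩ hclose
  have hePl : IsPlacement stretch p e := he
  have hePl' : IsPlacement stretch p' e' := he'
  -- The tile containing the origin in its interior determines a nearby tile of `T'`.
  have hcorr : ∀ i, ∃ j, |e i - e' j| < 1 / 4 ∧ |e (i + 1) - e' (j + 1)| < 1 / 4 := by
    intro i
    set x : EuclideanSpace ℝ (Fin 1) := EuclideanSpace.single 0 (e i + 1 / 2) with hx
    obtain ⟨δ, hδ0, hδ, hag⟩ := Tiling.exists_agreeUpTo_of_tilingDist_lt (by norm_num) (hclose x)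
    have hmono := hePl.add_sub_le one_le_stretch (by omega : i ≤ i + 1)
    have hx0 : x 0 = e i + 1 / 2 := by simp [hx]
    obtain ⟨t, hs, hd, -⟩ := hag.exists_corresponding
      (t := stretchedTile stretch p (fun j => e j - x 0) i) (y := 0)
      (by
        rw [tiles_translate_eq_range hT]
        exact ⟨i, rfl⟩)
      ((hePl.sub_const (x 0)).mem_interior_tileSupp_iff.mpr (by
        rw [hx0]
        push_cast at hmono
        simp only [PiLp.zero_apply]
        constructor <;> linarith))
      (by
        rw [norm_zero]
        positivity)
    rw [tiles_translate_eq_range hT'] at hs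
    obtain ⟨j, rfl⟩ := hs
    rw [(hePl.sub_const (x 0)).hausdorffDist_tileSupp (hePl'.sub_const (x 0))] at hd
    have h := abs_sub_le_of_hausdorffDist_Icc_le
      (((hePl.sub_const (x 0)).strictMono one_le_stretch).monotone (by omega))
      (((hePl'.sub_const (x 0)).strictMono one_le_stretch).monotone (by omega)) hd
    simp only [sub_sub_sub_cancel_right] at h
    exact ⟨j, h.1.trans_lt hδ, h.2.trans_lt hδ⟩
  choose j hj hj' using hcorr
  have hsucc : ∀ i, j (i + 1) = j i + 1 := by
    intro i
    have h1 := abs_lt.mp (hj (i + 1))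
    have h2 := abs_lt.mp (hj' i)
    rcases lt_trichotomy (j (i + 1)) (j i + 1) with h | h | h
    · have h3 := hePl'.add_sub_le one_le_stretch h.le
      have h4 : ((j (i + 1) : ℤ) : ℝ) + 1 ≤ (j i + 1 : ℤ) := by exact_mod_cast h
      linarith
    · exact h
    · have h3 := hePl'.add_sub_le one_le_stretch h.le
      have h4 : ((j i + 1 : ℤ) : ℝ) + 1 ≤ (j (i + 1) : ℤ) := by exact_mod_cast h
      linarith
  have hadd := Int.eq_add_of_forall_succ hsucc
  have heS := hePl'.shift (j 0)
  have hp : p = p' + (j 0 : ℤ) := by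
    by_contra hne
    obtain ⟨i, hi⟩ := exists_le_abs_sub_of_ne hePl heS hne
    have := hj i
    rw [hadd i] at this
    exact absurd this (not_lt.mpr hi)
  have hunique := (hePl.sub_const (e 0 - e' (j 0))).unique (hp ▸ heS) (by simp)
  refine ⟨EuclideanSpace.single 0 (e 0 - e' (j 0)), by simpa using hj 0, ?_⟩
  refine Tiling.ext ?_
  rw [tiles_translate_eq_range hT, hp]
  simp only [PiLp.single_apply, if_true]
  rw [funext hunique, range_stretchedTile_shift]
  exact hT'

/-! ### The solenoid as a suspension of the odometer -/

theorem DyadicSolenoid.eq_coe_of_le (x : DyadicSolenoid) {r : ℝ} {j k : ℕ} (hjk : j ≤ k)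
    (h : x.1 k = (r : AddCircle ((2 : ℝ) ^ k))) : x.1 j = (r : AddCircle ((2 : ℝ) ^ j)) := by
  have := x.sub_eq_coe_of_le ⟨fun _ => 0, fun _ => map_zero _⟩ hjk (by rw [sub_zero]; exact h)
  rwa [sub_zero] at this

theorem coe_int_eq_coe_int_iff {k : ℕ} {m n : ℤ} :
    ((m : ℝ) : AddCircle ((2 : ℝ) ^ k)) = ((n : ℝ) : AddCircle ((2 : ℝ) ^ k)) ↔
      (2 : ℤ) ^ k ∣ m - n := by
  rw [← sub_eq_zero, ← AddCircle.coe_sub, AddCircle.coe_eq_zero_iff]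
  constructor
  · rintro ⟨a, ha⟩
    rw [zsmul_eq_mul] at ha
    exact ⟨a, by rw [mul_comm]; exact_mod_cast ha.symm⟩
  · rintro ⟨a, ha⟩
    exact ⟨a, by rw [zsmul_eq_mul, mul_comm]; exact_mod_cast ha.symm⟩

theorem PadicInt.two_pow_dvd_int_iff {k : ℕ} {m : ℤ} :
    (2 : ℤ_[2]) ^ k ∣ (m : ℤ_[2]) ↔ (2 : ℤ) ^ k ∣ m := by
  have := PadicInt.pow_p_dvd_int_iff (p := 2) k m
  simpa using this

theorem PadicInt.two_pow_dvd_iff_norm_le {k : ℕ} {x : ℤ_[2]} :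
    (2 : ℤ_[2]) ^ k ∣ x ↔ ‖x‖ ≤ (2 : ℝ) ^ (-k : ℤ) := by
  have := PadicInt.norm_le_pow_iff_mem_span_pow x k
  rw [Ideal.mem_span_singleton] at this
  simpa using this.symm

theorem PadicInt.eq_zero_of_forall_two_pow_dvd {x : ℤ_[2]} (h : ∀ k : ℕ, (2 : ℤ_[2]) ^ k ∣ x) :
    x = 0 := by
  by_contra hx
  obtain ⟨k, hk⟩ := PadicInt.exists_pow_neg_lt 2 (norm_pos_iff.mpr hx)
  exact absurd (PadicInt.two_pow_dvd_iff_norm_le.mp (h k)) (not_le.mpr (by simpa using hk))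

theorem PadicInt.two_pow_dvd_sub_appr (p : ℤ_[2]) (k : ℕ) :
    (2 : ℤ_[2]) ^ k ∣ p - ((p.appr k : ℤ) : ℤ_[2]) := by
  have := PadicInt.appr_spec k p
  rw [Ideal.mem_span_singleton] at this
  simpa using this

/-- The residue class of a `2`-adic integer modulo `2 ^ k`, as a point of the circle. -/
noncomputable def residuePoint (k : ℕ) (p : ℤ_[2]) : AddCircle ((2 : ℝ) ^ k) :=
  (((p.appr k : ℤ) : ℝ) : AddCircle ((2 : ℝ) ^ k))

theorem residuePoint_eq_coe_iff {k : ℕ} {p : ℤ_[2]} {m : ℤ} :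
    residuePoint k p = ((m : ℝ) : AddCircle ((2 : ℝ) ^ k)) ↔ (2 : ℤ_[2]) ^ k ∣ p - m := by
  rw [residuePoint, coe_int_eq_coe_int_iff, ← PadicInt.two_pow_dvd_int_iff, Int.cast_sub,
    ← dvd_add_right (PadicInt.two_pow_dvd_sub_appr p k), sub_add_sub_cancel]

theorem exists_residuePoint_eq (k : ℕ) (p : ℤ_[2]) :
    ∃ m : ℤ, residuePoint k p = ((m : ℝ) : AddCircle ((2 : ℝ) ^ k)) ∧ (2 : ℤ_[2]) ^ k ∣ p - m :=
  ⟨_, rfl, PadicInt.two_pow_dvd_sub_appr p k⟩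

theorem residuePoint_add_int (k : ℕ) (p : ℤ_[2]) (m : ℤ) :
    residuePoint k (p + m) = residuePoint k p + ((m : ℝ) : AddCircle ((2 : ℝ) ^ k)) := by
  obtain ⟨n, hn, hdvd⟩ := exists_residuePoint_eq k p
  rw [hn, ← AddCircle.coe_add, ← Int.cast_add, residuePoint_eq_coe_iff, Int.cast_add,
    add_sub_add_right_eq_sub]
  exact hdvd

theorem continuous_residuePoint (k : ℕ) : Continuous (residuePoint k) := by
  refine IsLocallyConstant.continuous ((IsLocallyConstant.iff_eventually_eq _).mpr fun p => ?_)
  filter_upwards [closedBall_mem_nhds p (show (0 : ℝ) < 2 ^ (-k : ℤ) by positivity)] with p' hp'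
  rw [mem_closedBall, dist_eq_norm, ← PadicInt.two_pow_dvd_iff_norm_le] at hp'
  obtain ⟨n, hn, hdvd⟩ := exists_residuePoint_eq k p
  rw [hn, residuePoint_eq_coe_iff, ← sub_add_sub_cancel p' p]
  exact dvd_add hp' hdvd

/-- The point of the solenoid at height `q.2` above the point `q.1` of the odometer. -/
noncomputable def suspensionPoint (q : ℤ_[2] × ℝ) : DyadicSolenoid :=
  ⟨fun k => residuePoint k q.1 + (q.2 : AddCircle ((2 : ℝ) ^ k)), fun k => by
    obtain ⟨n, hn, hdvd⟩ := exists_residuePoint_eq (k + 1) q.1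
    have hk := residuePoint_eq_coe_iff.mpr ((pow_dvd_pow 2 k.le_succ).trans hdvd)
    simp only [map_add, hn, hk, dyadicBond_coe]⟩

theorem continuous_suspensionPoint : Continuous suspensionPoint :=
  Continuous.subtype_mk (continuous_pi fun k => ((continuous_residuePoint k).comp
    continuous_fst).add ((AddCircle.continuous_mk' _).comp continuous_snd)) _

theorem suspensionPoint_eq_iff {q q' : ℤ_[2] × ℝ} :
    suspensionPoint q = suspensionPoint q' ↔ ∃ m : ℤ, q = (q'.1 + m, q'.2 - m) := by
  constructor
  · intro h
    have hk : ∀ k, residuePoint k q.1 + (q.2 : AddCircle ((2 : ℝ) ^ k)) =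
        residuePoint k q'.1 + (q'.2 : AddCircle ((2 : ℝ) ^ k)) := fun k =>
      congrFun (congrArg Subtype.val h) k
    have hzero : ∀ p, residuePoint 0 p = 0 := fun p => by
      have := residuePoint_eq_coe_iff (k := 0) (p := p) (m := 0)
      simpa using this
    have h0 := hk 0
    rw [hzero, hzero, zero_add, zero_add, eq_comm, ← sub_eq_zero, ← AddCircle.coe_sub,
      AddCircle.coe_eq_zero_iff] at h0
    obtain ⟨m, hm⟩ := h0
    rw [pow_zero, zsmul_one] at hm
    refine ⟨m, Prod.ext ?_ (by simp only; linarith)⟩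
    refine sub_eq_zero.mp (PadicInt.eq_zero_of_forall_two_pow_dvd fun k => ?_)
    obtain ⟨n, hn, hdvd⟩ := exists_residuePoint_eq k (q'.1 + m)
    have h1 : residuePoint k q.1 = residuePoint k (q'.1 + m) := by
      rw [residuePoint_add_int, hm, AddCircle.coe_sub, ← add_sub_assoc, ← hk k,
        add_sub_cancel_right]
    rw [← sub_sub_sub_cancel_right _ _ (n : ℤ_[2])]
    exact dvd_sub (residuePoint_eq_coe_iff.mp (h1.trans hn)) hdvd
  · rintro ⟨m, rfl⟩
    refine Subtype.ext (funext fun k => ?_)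
    simp only [suspensionPoint, residuePoint_add_int, AddCircle.coe_sub]
    abel

/-- The points of the solenoid above the odometer at heights in `[0, 1]` are dense, and form a
compact set. -/
theorem surjective_suspensionPoint :
    Function.Surjective fun a : ℤ_[2] × Icc (0 : ℝ) 1 => suspensionPoint (a.1, a.2) := by
  have hcont : Continuous fun a : ℤ_[2] × Icc (0 : ℝ) 1 => suspensionPoint (a.1, a.2) :=
    continuous_suspensionPoint.comp (by fun_prop)
  intro x
  have hr : ∀ k, ∃ r : ℝ, (r : AddCircle ((2 : ℝ) ^ k)) = x.1 k := fun k =>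
    QuotientAddGroup.mk_surjective _
  choose r hr using hr
  suffices hlim : Filter.Tendsto (fun n => suspensionPoint ((⌊r n⌋ : ℤ_[2]), Int.fract (r n)))
      Filter.atTop (𝓝 x) by
    exact (isCompact_range hcont).isClosed.mem_of_tendsto hlim
      (Filter.Eventually.of_forall fun n => ⟨((⌊r n⌋ : ℤ_[2]),
        ⟨Int.fract (r n), Int.fract_nonneg _, (Int.fract_lt_one _).le⟩), rfl⟩)
  rw [tendsto_subtype_rng, tendsto_pi_nhds]
  intro k
  refine tendsto_const_nhds.congr' ?_
  filter_upwards [Filter.eventually_ge_atTop k] with n hn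
  simp only [suspensionPoint]
  rw [residuePoint_eq_coe_iff.mpr (by rw [sub_self]; exact dvd_zero _), ← AddCircle.coe_add,
    Int.floor_add_fract]
  exact x.eq_coe_of_le hn (hr n).symm

theorem DyadicSolenoid.isTotallyDisconnected_fiber :
    IsTotallyDisconnected {x : DyadicSolenoid | x.1 0 = 0} := by
  intro t ht hconn x hx y hy
  refine Subtype.ext (funext fun k => ?_)
  have himg : IsPreconnected ((fun x : DyadicSolenoid => x.1 k) '' t) :=
    hconn.image _ ((continuous_apply k).comp continuous_subtype_val).continuousOn
  have hcount : (range fun m : ℤ => ((m : ℝ) : AddCircle ((2 : ℝ) ^ k))).Countable :=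
    countable_range _
  refine hcount.isTotallyDisconnected _ ?_ himg ⟨x, hx, rfl⟩ ⟨y, hy, rfl⟩
  rintro _ ⟨z, hz, rfl⟩
  obtain ⟨r, hr⟩ := QuotientAddGroup.mk_surjective (z.1 k)
  have h0 := z.eq_coe_of_le (Nat.zero_le k) hr.symm
  rw [ht hz, eq_comm, AddCircle.coe_eq_zero_iff] at h0
  obtain ⟨m, hm⟩ := h0
  rw [pow_zero, zsmul_one] at hm
  exact ⟨m, by simp only [hm]; exact hr⟩

/-! ### The homeomorphism of the stretched solenoid with the solenoid -/

theorem Topology.IsQuotientMap.exists_homeomorph {X Y Z : Type*} [TopologicalSpace X]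
    [TopologicalSpace Y] [TopologicalSpace Z] {f : X → Y} {g : X → Z} (hf : IsQuotientMap f)
    (hg : IsQuotientMap g) (h : ∀ a b, f a = f b ↔ g a = g b) :
    ∃ φ : Y ≃ₜ Z, ∀ a, φ (f a) = g a := by
  have hfs := hf.surjective
  have hgs := hg.surjective
  have hgf : ∀ a, g (Function.surjInv hfs (f a)) = g a := fun a =>
    (h _ _).mp (Function.surjInv_eq hfs _)
  have hfg : ∀ a, f (Function.surjInv hgs (g a)) = f a := fun a =>
    (h _ _).mpr (Function.surjInv_eq hgs _)
  refine ⟨⟨⟨fun y => g (Function.surjInv hfs y), fun z => f (Function.surjInv hgs z), fun y => ?_,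
    fun z => ?_⟩, hf.continuous_iff.mpr ?_, hg.continuous_iff.mpr ?_⟩, hgf⟩
  · simp only [hfg, Function.surjInv_eq]
  · simp only [hgf, Function.surjInv_eq]
  · exact hg.continuous.congr fun a => (hgf a).symm
  · exact hf.continuous.congr fun a => (hfg a).symm

section Stretched

variable {len : C(ℤ_[2], ℝ)} {hlen : ∀ q, 0 < len q}

/-- The odometer tiling in which the origin divides the tile at the point `a.1` of the odometer in
the proportion `a.2`. -/
noncomputable def proportionTiling (len : C(ℤ_[2], ℝ)) (hlen : ∀ q, 0 < len q)
    (h1 : ∀ q, 1 ≤ len q) (a : ℤ_[2] × Icc (0 : ℝ) 1) : stretchedSolenoid len hlen :=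
  ⟨odometerTiling len hlen h1 (a.1, a.2 * len a.1), by
    rw [stretchedSolenoid_eq_range h1]
    exact mem_range_self _⟩

theorem continuous_proportion (len : C(ℤ_[2], ℝ)) :
    Continuous fun a : ℤ_[2] × Icc (0 : ℝ) 1 => (a.1, (a.2 : ℝ) * len a.1) := by
  fun_prop

theorem continuous_proportionTiling (h1 : ∀ q, 1 ≤ len q) :
    Continuous (proportionTiling len hlen h1) :=
  ((continuous_odometerTiling h1).comp (continuous_proportion len)).subtype_mk _

theorem surjective_proportionTiling (h1 : ∀ q, 1 ≤ len q) :
    Function.Surjective (proportionTiling len hlen h1) := by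
  rintro ⟨T, hT⟩
  rw [stretchedSolenoid_eq_range h1] at hT
  obtain ⟨q, rfl⟩ := hT
  obtain ⟨i, hi, hi'⟩ := (isPlacement_odometerSum len q.1).exists_index h1 q.2
  rw [isPlacement_odometerSum len q.1 i] at hi'
  have hpos := hlen (q.1 + i)
  refine ⟨(q.1 + i, ⟨(q.2 - odometerSum len q.1 i) / len (q.1 + i),
    div_nonneg (by linarith) hpos.le, (div_le_one hpos).mpr (by linarith)⟩), Subtype.ext ?_⟩
  simp only [proportionTiling]
  rw [div_mul_cancel₀ _ hpos.ne']
  exact odometerTiling_add h1 q i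

theorem isClosed_stretchedSolenoid (h1 : ∀ q, 1 ≤ len q) :
    IsClosed (stretchedSolenoid len hlen) := by
  have : stretchedSolenoid len hlen = odometerTiling len hlen h1 ''
      range fun a : ℤ_[2] × Icc (0 : ℝ) 1 => (a.1, (a.2 : ℝ) * len a.1) := by
    rw [← range_comp]
    ext T
    constructor
    · intro hT
      obtain ⟨a, ha⟩ := surjective_proportionTiling h1 ⟨T, hT⟩
      exact ⟨a, congrArg Subtype.val ha⟩
    · rintro ⟨a, rfl⟩
      exact (proportionTiling len hlen h1 a).2
  rw [this]
  exact isClosed_image_odometerTiling h1 (isCompact_range (continuous_proportion len))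

theorem isClosedMap_proportionTiling (h1 : ∀ q, 1 ≤ len q) :
    IsClosedMap (proportionTiling len hlen h1) := by
  intro A hA
  have hc : IsClosed (odometerTiling len hlen h1 ''
      ((fun a : ℤ_[2] × Icc (0 : ℝ) 1 => (a.1, (a.2 : ℝ) * len a.1)) '' A)) :=
    isClosed_image_odometerTiling h1 (hA.isCompact.image (continuous_proportion len))
  convert hc.preimage (continuous_subtype_val (p := (· ∈ stretchedSolenoid len hlen))) using 1
  rw [image_image]
  ext T
  constructor
  · rintro ⟨a, ha, rfl⟩
    exact ⟨a, ha, rfl⟩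
  · rintro ⟨a, ha, h⟩
    exact ⟨a, ha, Subtype.ext h⟩

/-- Stretching the tiles to length `1` respects the identification of the right end of a tile with
the left end of the next one. -/
theorem proportionTiling_eq_iff (h1 : ∀ q, 1 ≤ len q) (a b : ℤ_[2] × Icc (0 : ℝ) 1) :
    proportionTiling len hlen h1 a = proportionTiling len hlen h1 b ↔
      suspensionPoint (a.1, a.2) = suspensionPoint (b.1, b.2) := by
  obtain ⟨p, t, ht0, ht1⟩ := a
  obtain ⟨p', t', ht0', ht1'⟩ := b
  rw [suspensionPoint_eq_iff, ← Subtype.coe_inj]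
  change odometerTiling len hlen h1 (p, t * len p) =
    odometerTiling len hlen h1 (p', t' * len p') ↔ _
  rw [odometerTiling_eq_iff]
  simp only [Prod.mk.injEq]
  refine exists_congr fun m => and_congr_right fun hp => ?_
  have hE := isPlacement_odometerSum len p'
  have hpos := hlen p
  have hpos' := hlen p'
  have hsucc := hE m
  rw [← hp] at hsucc
  have hone : odometerSum len p' 1 = len p' := by
    have := hE 0
    rwa [odometerSum_zero, zero_add, zero_add, Int.cast_zero, add_zero] at this
  have hb0 : 0 ≤ t * len p := by positivity
  have hb1 : t * len p ≤ len p := mul_le_of_le_one_left hpos.le ht1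
  have hb0' : 0 ≤ t' * len p' := by positivity
  have hb1' : t' * len p' ≤ len p' := mul_le_of_le_one_left hpos'.le ht1'
  rcases lt_trichotomy m 0 with hm | rfl | hm
  · have hle := hE.add_sub_le h1 (by omega : m + 1 ≤ 0)
    rw [odometerSum_zero, hsucc] at hle
    rcases (by omega : m ≤ -2 ∨ m = -1) with hm | rfl
    · have hmR : (m : ℝ) ≤ -2 := by exact_mod_cast hm
      push_cast at hle
      constructor <;> intro h <;> exfalso <;> linarith
    · rw [neg_add_cancel, odometerSum_zero] at hsucc
      push_cast
      constructor
      · intro h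
        have h2 : t' * len p' = 0 := by linarith
        have h3 : (t - 1) * len p = 0 := by linarith
        have h4 := (mul_eq_zero.mp h2).resolve_right hpos'.ne'
        have h5 := (mul_eq_zero.mp h3).resolve_right hpos.ne'
        linarith
      · intro h
        have h4 : t' = 0 := by linarith
        have h5 : t = 1 := by linarith
        rw [h4, h5]
        linarith
  · rw [Int.cast_zero, add_zero] at hp
    rw [odometerSum_zero, Int.cast_zero, sub_zero, sub_zero, hp]
    exact ⟨fun h => mul_right_cancel₀ hpos'.ne' h, fun h => by rw [h]⟩
  · have hle := hE.add_sub_le h1 (by omega : 1 ≤ m)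
    rw [hone] at hle
    rcases (by omega : 2 ≤ m ∨ m = 1) with hm | rfl
    · have hmR : (2 : ℝ) ≤ m := by exact_mod_cast hm
      push_cast at hle
      constructor <;> intro h <;> exfalso <;> linarith
    · rw [hone]
      push_cast
      constructor
      · intro h
        have h2 : t * len p = 0 := by linarith
        have h3 : (t' - 1) * len p' = 0 := by linarith
        have h4 := (mul_eq_zero.mp h2).resolve_right hpos.ne'
        have h5 := (mul_eq_zero.mp h3).resolve_right hpos'.ne'
        linarith
      · intro h
        have h4 : t = 0 := by linarith
        have h5 : t' = 1 := by linarith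
        rw [h4, h5]
        linarith

theorem exists_homeomorph_stretchedSolenoid (h1 : ∀ q, 1 ≤ len q) :
    ∃ φ : stretchedSolenoid len hlen ≃ₜ DyadicSolenoid, ∀ a : ℤ_[2] × Icc (0 : ℝ) 1,
      φ (proportionTiling len hlen h1 a) = suspensionPoint (a.1, a.2) := by
  have hσ : Continuous fun a : ℤ_[2] × Icc (0 : ℝ) 1 => suspensionPoint (a.1, a.2) :=
    continuous_suspensionPoint.comp (by fun_prop)
  exact IsQuotientMap.exists_homeomorph
    ((isClosedMap_proportionTiling h1).isQuotientMap (continuous_proportionTiling h1)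
      (surjective_proportionTiling h1))
    (hσ.isClosedMap.isQuotientMap hσ surjective_suspensionPoint) (proportionTiling_eq_iff h1)

theorem isTilingSpace_stretchedSolenoid (h1 : ∀ q, 1 ≤ len q) :
    Tiling.IsTilingSpace (stretchedSolenoid len hlen) := by
  refine ⟨isClosed_stretchedSolenoid h1, ?_⟩
  rintro T ⟨p, e, he, hT⟩ x
  exact ⟨p, fun i => e i - x 0, IsPlacement.sub_const he (x 0), tiles_translate_eq_range hT x⟩

theorem isTotallyDisconnected_transversal (h1 : ∀ q, 1 ≤ len q) :
    IsTotallyDisconnected (Tiling.transversal (stretchedSolenoid len hlen)) := by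
  obtain ⟨φ, hφ⟩ := exists_homeomorph_stretchedSolenoid (hlen := hlen) h1
  have himg : Tiling.transversal (stretchedSolenoid len hlen) = Subtype.val ''
      {T : stretchedSolenoid len hlen | T.1 ∈ Tiling.transversal (stretchedSolenoid len hlen)} := by
    ext T
    exact ⟨fun h => ⟨⟨T, h.1⟩, h, rfl⟩, by rintro ⟨T, h, rfl⟩; exact h⟩
  rw [himg, IsEmbedding.subtypeVal.isTotallyDisconnected_image,
    ← φ.isEmbedding.isTotallyDisconnected_image]
  refine fun t ht => DyadicSolenoid.isTotallyDisconnected_fiber t (ht.trans ?_)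
  rintro _ ⟨⟨T, hT⟩, ⟨-, l, hl⟩, rfl⟩
  rw [stretchedSolenoid_eq_range h1] at hT
  obtain ⟨q, rfl⟩ := hT
  obtain ⟨i, hi⟩ := hl
  have h0 : odometerSum len q.1 i - q.2 = 0 := by
    simpa [stretchedTile] using congrArg (fun t => t.2 0) hi
  have heq := odometerTiling_add (hlen := hlen) h1 q i
  have hT : proportionTiling len hlen h1 (q.1 + i, ⟨0, left_mem_Icc.mpr zero_le_one⟩) =
      ⟨odometerTiling len hlen h1 q, by assumption⟩ := by
    refine Subtype.ext ?_
    simp only [proportionTiling, zero_mul]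
    rw [← heq]
    congr 2
    linarith
  rw [← hT, hφ]
  simp only [suspensionPoint, mem_ofPred_eq]
  rw [AddCircle.coe_zero, add_zero]
  have := residuePoint_eq_coe_iff (k := 0) (p := q.1 + i) (m := 0)
  simpa using this

end Stretched

theorem mainTheorem3 :
    ∃ (len : C(ℤ_[2], ℝ)) (hlen : ∀ q, 0 < len q),
      Tiling.IsTilingSpace (stretchedSolenoid len hlen) ∧
      IsTotallyDisconnected (Tiling.transversal (stretchedSolenoid len hlen)) ∧
      Tiling.IsExpansive (stretchedSolenoid len hlen) ∧
      Nonempty (stretchedSolenoid len hlen ≃ₜ DyadicSolenoid) ∧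
      ∀ (d : ℕ) (L : Type*) [MetricSpace L] [CompactSpace L] (P : PrototileSet d L)
        (Ω : Set (Tiling P)), Tiling.IsTilingSpace Ω → Tiling.IsFLC Ω →
          IsEmpty (stretchedSolenoid len hlen ≃ₜ Ω) := by
  obtain ⟨φ, -⟩ := exists_homeomorph_stretchedSolenoid (hlen := stretch_pos) one_le_stretch
  refine ⟨stretch, stretch_pos, isTilingSpace_stretchedSolenoid one_le_stretch,
    isTotallyDisconnected_transversal one_le_stretch, isExpansive_stretchedSolenoid, ⟨φ⟩, ?_⟩
  intro d L _ _ P Ω hΩ h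
  exact ⟨fun ψ => (h.isEmpty_homeomorph hΩ).false (φ.symm.trans ψ)⟩
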